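/- Let $\mathcal C$ be a non-empty measurable space, let $\sigma\in(0,\infty)$, and let $(\rho_{x,y})_{x,y\in\mathcal C}$ be a kernel of non-negative measures from $\mathcal C\times\mathcal C$ to $\mathcal C$ that is balanced: $\rho_{x,y}(\mathcal C)=\sigma$ for all $x,y\in\mathcal C$. Write $\mathcal P(\mathcal S)$ for the set of probability measures on a measurable space $\mathcal S$. For measures $\mu,\nu$ on $\mathcal C$ put $$\mathcal R(\mu,\nu)=\int_{\mathcal C}\int_{\mathcal C}\rho_{x,y}\,\mathrm d\nu(x)\,\mathrm d\mu(y),$$ and for measures $\mu,\nu$ on $\mathcal C\times\mathcal C$ put $$\mathcal T(\mu,\nu)=\frac1{\sigma^2}\int_{\mathcal C\times\mathcal C}\int_{\mathcal C\times\mathcal C}\rho_{x_1,x_2}\otimes\rho_{y_1,y_2}\,\mathrm d\mu(x_1,x_2)\,\mathrm d\nu(y_1,y_2).$$ For an operator $\mathcal K:\mathcal P(\mathcal S)\to\mathcal P(\mathcal S)$ let $$|||\mathcal K|||=\sup_{\nu_1\neq\nu_2\in\mathcal P(\mathcal S)}\frac{\|\mathcal K(\nu_1)-\mathcal K(\nu_2)\|_{\mathrm{TV}}}{\|\nu_1-\nu_2\|_{\mathrm{TV}}}$$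 (a supremum over the empty set being $0$), and let $$\tau_\ell(\mathcal T)=\sup_{\mu\in\mathcal P(\mathcal C\times\mathcal C)}|||\mathcal T(\mu,\cdot)|||,\qquad \tau_r(\mathcal T)=\sup_{\nu\in\mathcal P(\mathcal C\times\mathcal C)}|||\mathcal T(\cdot,\nu)|||.$$ Assume that $\tau_\ell(\mathcal T)+\tau_r(\mathcal T)<1$. Then there is a unique $\nu\in\mathcal P(\mathcal C)$ such that $\sigma\nu=\mathcal R(\nu,\nu)$. Moreover, let $m_0$ be a non-zero finite non-negative measure on $\mathcal C$ and let $(m_n)_{n\ge0}$ be a two-drawing Pólya process with initial composition $m_0$ and replacement kernel $\rho$. That is, for every $n\ge0$, conditionally on the past up to time $n$, the pair $(C_1(n+1),C_2(n+1))$ has distribution $\hat m_n\otimes\hat m_n$, where $\hat m_n=m_n/m_n(\mathcal C)$, and $$m_{n+1}=m_n+\rho_{C_1(n+1),C_2(n+1)}.$$ Then $\hat m_n\to\nu$ in probability as $n\to\infty$, for the topology of weak convergence on $\mathcal P(\mathcal C)$, that is, the coarsest topology for which $\mu\mapsto\int f\,\mathrm d\mu$ is continuous for every bounded measurable $f:\mathcal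 C\to\mathbb R$. In other words, $\mathbb P(\hat m_n\notin U)\to0$ for every open set $U\ni\nu$ of this topology. -/

import Mathlib

open MeasureTheory ProbabilityTheory Filter Topology
open scoped ENNReal NNReal

universe u v

noncomputable section

namespace PolyaUrn

/-- The total variation distance `sup_A |μ(A) - ν(A)|` of two finite measures, `A` ranging over the
measurable sets. (The total variation norm of `μ - ν` is twice this number when `μ` and `ν` have
the same mass, so the ratios in `ergodicityCoeff` do not depend on this convention.) -/
def tvDist {S : Type*} [MeasurableSpace S] (μ ν : Measure S) : ℝ≥0∞ :=
  ⨆ (A : Set S) (_ : MeasurableSet A), ENNReal.ofReal |μ.real A - ν.real A|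

/-- The norm-based (Dobrushin) ergodicity coefficient of an operator `K` on probability measures:
the supremum of `‖K ν₁ - K ν₂‖ / ‖ν₁ - ν₂‖` over distinct probability measures `ν₁`, `ν₂`. -/
def ergodicityCoeff {S : Type*} [MeasurableSpace S] (K : Measure S → Measure S) : ℝ≥0∞ :=
  ⨆ (ν₁ : ProbabilityMeasure S) (ν₂ : ProbabilityMeasure S) (_ : ν₁ ≠ ν₂),
    tvDist (K ν₁) (K ν₂) / tvDist (ν₁ : Measure S) (ν₂ : Measure S)

/-- `τ_ℓ(T)`: the supremum over `μ` of the coefficients of the operators `ν ↦ T(μ, ν)`. -/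
def tauLeft {S : Type*} [MeasurableSpace S] (T : Measure S → Measure S → Measure S) : ℝ≥0∞ :=
  ⨆ μ : ProbabilityMeasure S, ergodicityCoeff (fun ν => T μ ν)

/-- `τ_r(T)`: the supremum over `ν` of the coefficients of the operators `μ ↦ T(μ, ν)`. -/
def tauRight {S : Type*} [MeasurableSpace S] (T : Measure S → Measure S → Measure S) : ℝ≥0∞ :=
  ⨆ ν : ProbabilityMeasure S, ergodicityCoeff (fun μ => T μ ν)

variable {C : Type*} [MeasurableSpace C]

/-- The operator `R(μ, ν) = ∫ ∫ ρ_{x,y} dν(x) dμ(y)`. -/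
def replacementOp (ρ : Kernel (C × C) C) (μ ν : Measure C) : Measure C :=
  (ν.prod μ).bind ρ

/-- The operator on measures on `C × C` given by
`T(μ, ν) = σ⁻² ∫ ∫ ρ_{x₁,x₂} ⊗ ρ_{y₁,y₂} dμ(x₁,x₂) dν(y₁,y₂)`. -/
def pairOp (ρ : Kernel (C × C) C) (σ : ℝ≥0) (μ ν : Measure (C × C)) : Measure (C × C) :=
  (σ ^ 2)⁻¹ • (μ.prod ν).bind
    (fun p : (C × C) × (C × C) => (ρ p.1).prod (ρ p.2))

/-- `m` is a two-drawing Pólya process on `C` with initial composition `m₀`, replacement kernel `ρ`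
and drawn colours `C₁ n`, `C₂ n` (`n ≥ 1`), for the filtration `ℱ` of events up to time `n`:
given the past up to time `n`, the pair `(C₁ (n+1), C₂ (n+1))` has distribution `m̂ₙ ⊗ m̂ₙ`, where
`m̂ₙ` is `mₙ` divided by its mass, and `m_{n+1} = m_n + ρ_{C₁ (n+1), C₂ (n+1)}`. -/
structure IsPolyaProcess {Ω : Type*} {mΩ : MeasurableSpace Ω} [Nonempty C] (P : Measure Ω)
    (ℱ : Filtration ℕ mΩ) (ρ : Kernel (C × C) C) (m₀ : FiniteMeasure C)
    (m : ℕ → Ω → FiniteMeasure C) (C₁ C₂ : ℕ → Ω → C) : Prop where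
  zero : ∀ ω, m 0 ω = m₀
  measurable_fst : ∀ n, Measurable[ℱ (n + 1)] (C₁ (n + 1))
  measurable_snd : ∀ n, Measurable[ℱ (n + 1)] (C₂ (n + 1))
  cond_law : ∀ (n : ℕ) (A : Set (C × C)), MeasurableSet A →
    P⟦(fun ω => (C₁ (n + 1) ω, C₂ (n + 1) ω)) ⁻¹' A | ℱ n⟧ =ᵐ[P]
      fun ω => (((m n ω).normalize : Measure C).prod ((m n ω).normalize : Measure C)).real A
  succ : ∀ n ω, (m (n + 1) ω : Measure C) = (m n ω : Measure C) + ρ (C₁ (n + 1) ω, C₂ (n + 1) ω)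

/-- The topology of weak convergence on the probability measures on a measurable space: the coarsest
one that makes `μ ↦ ∫ f dμ` continuous for every bounded measurable `f`. -/
abbrev weakTopology (C : Type*) [MeasurableSpace C] : TopologicalSpace (ProbabilityMeasure C) :=
  ⨅ (f : C → ℝ) (_ : Measurable f ∧ ∃ B : ℝ, ∀ x, |f x| ≤ B),
    TopologicalSpace.induced (fun μ : ProbabilityMeasure C => ∫ x, f x ∂(μ : Measure C)) inferInstance

/-- Convergence in probability of random probability measures `M n` to `ν`, for `weakTopology`:
`M n` lies in any given neighbourhood of `ν` with probability tending to one. -/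
def TendstoWeaklyInProbability {Ω : Type*} {mΩ : MeasurableSpace Ω} (P : Measure Ω)
    (M : ℕ → Ω → ProbabilityMeasure C) (ν : ProbabilityMeasure C) : Prop :=
  ∀ U : Set (ProbabilityMeasure C), IsOpen[weakTopology C] U → ν ∈ U →
    Tendsto (fun n => P {ω | M n ω ∉ U}) atTop (𝓝 0)

end PolyaUrn

end

/-! Let `K` be the Markov kernel σ⁻¹ρ. On Dirac masses `T(δ_p, δ_q)` is the product of `K p` and `K
q`, so each of the two coefficients bounds the total variation distance between any two values of
`K`; their sum being below 1, `K` has Dobrushin coefficient at most some κ with 2κ < 1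
(`exists_contraction_const`). Hence `m ↦ drawOp K m m` contracts total variation by 2κ, which gives
existence and uniqueness of ν.

For convergence, take a functional Φ of j probability measures, affine in each, and look at `a n = E
Φ(M n, …, M n)` along the normalized compositions. A draw moves `M n` by a fraction γ n towards `K
X`, with X a pair drawn independently from `M n`. To first order in γ n, the mean relaxes at rate jγ
n towards the average over i of the means of the functionals in which coordinate i is split into its
two parents (`IsUrn.abs_integral_succ_sub_le`). These have j + 1 coordinates and the same value at
ν, but their total oscillation has dropped by (1 - 2κ)δ i (`sum_splitOsc`). As γ is not summable,
asymptotic bounds for the split functionals pass to Φ with a gain 1 - (1 - 2κ)/j. After N rounds the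
gain is the product of 1 - (1 - 2κ)/(j + k) over k < N, which tends to 0 because the harmonic series
diverges. So `a n` tends to the value at ν (`IsUrn.tendsto_integral`). With j = 2 and Φ a product of
two integrals of a centred test function, this is convergence of second moments to 0, and
Chebyshev's inequality concludes. -/

noncomputable section

namespace PolyaUrn

variable {C : Type*} [MeasurableSpace C]

/-! ### Oscillation and total variation -/

section Oscillation

lemma abs_le_of_osc {S : Type*} {φ : S → ℝ} {δ : ℝ} (ho : ∀ x y, φ x - φ y ≤ δ) (x₀ x : S) :
    |φ x| ≤ |φ x₀| + δ := by
  have h1 := ho x x₀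
  have h2 := ho x₀ x
  have h3 := neg_abs_le (φ x₀)
  have h4 := le_abs_self (φ x₀)
  exact abs_le.2 ⟨by linarith, by linarith⟩

lemma integrable_of_osc {S : Type*} [MeasurableSpace S] {μ : Measure S} [IsFiniteMeasure μ]
    {φ : S → ℝ} {δ : ℝ} (hφ : Measurable φ) (ho : ∀ x y, φ x - φ y ≤ δ) : Integrable φ μ := by
  rcases isEmpty_or_nonempty S with h | ⟨⟨x₀⟩⟩
  · simp [Measure.eq_zero_of_isEmpty μ]
  · exact Integrable.of_bound hφ.aestronglyMeasurable (|φ x₀| + δ)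
      (Eventually.of_forall fun x => abs_le_of_osc ho x₀ x)

/-- The integral of a function of oscillation at most `δ` against two probability measures
at total variation distance at most `t` differs by at most `δ * t`. -/
lemma integral_sub_le_of_osc {S : Type*} [MeasurableSpace S] {μ μ' : Measure S}
    [IsProbabilityMeasure μ] [IsProbabilityMeasure μ']
    {φ : S → ℝ} {δ t : ℝ} (hφ : Measurable φ) (ho : ∀ x y, φ x - φ y ≤ δ)
    (ht : ∀ A, MeasurableSet A → μ.real A - μ'.real A ≤ t) :
    ∫ x, φ x ∂μ - ∫ x, φ x ∂μ' ≤ δ * t := by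
  have : Nonempty S := μ.nonempty_of_neZero
  obtain ⟨x₀⟩ := this
  have hδ : 0 ≤ δ := by simpa using ho x₀ x₀
  have hbdd : BddBelow (Set.range φ) := by
    refine ⟨φ x₀ - δ, ?_⟩
    rintro _ ⟨x, rfl⟩
    linarith [ho x₀ x]
  set c := ⨅ x, φ x with hc
  have h0 : ∀ x, 0 ≤ φ x - c := fun x => sub_nonneg.2 (ciInf_le hbdd x)
  have h1 : ∀ x, φ x - c ≤ δ := by
    intro x
    have : φ x - δ ≤ c := by
      have : Nonempty S := ⟨x₀⟩
      exact le_ciInf fun y => by linarith [ho x y]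
    linarith
  -- Layer cake: `φ - c` takes values in [0, δ], so its integral is that of its tail probabilities
  -- over (0, δ], and each tail differs by at most `t`.
  have key : ∀ (ξ : Measure S) [IsProbabilityMeasure ξ],
      ∫ x, φ x ∂ξ = (∫ s in Set.Ioc 0 δ, ξ.real {a | s ≤ φ a - c}) + c := by
    intro ξ _
    have hi : Integrable φ ξ := integrable_of_osc hφ ho
    rw [← Integrable.integral_eq_integral_Ioc_meas_le (μ := ξ) (f := fun x => φ x - c)
      (hi.sub (integrable_const c)) (Eventually.of_forall h0) (Eventually.of_forall h1),
      integral_sub hi (integrable_const c)]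
    simp
  have hint : ∀ (ξ : Measure S) [IsProbabilityMeasure ξ],
      Integrable (fun s => ξ.real {a | s ≤ φ a - c}) (volume.restrict (Set.Ioc 0 δ)) := by
    intro ξ _
    have hanti : Antitone fun s : ℝ => ξ.real {a | s ≤ φ a - c} :=
      fun a b hab => measureReal_mono fun x (hx : b ≤ φ x - c) => hab.trans hx
    refine Integrable.of_bound hanti.measurable.aestronglyMeasurable 1
      (Eventually.of_forall fun s => ?_)
    rw [Real.norm_of_nonneg measureReal_nonneg]
    exact measureReal_le_one
  rw [key μ, key μ', add_sub_add_right_eq_sub, ← integral_sub (hint μ) (hint μ')]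
  calc ∫ s in Set.Ioc 0 δ, (μ.real {a | s ≤ φ a - c} - μ'.real {a | s ≤ φ a - c})
      ≤ ∫ _ in Set.Ioc 0 δ, t := by
        refine integral_mono ((hint μ).sub (hint μ')) (integrable_const t) fun s => ?_
        exact ht _ (measurableSet_le measurable_const (hφ.sub measurable_const))
    _ = δ * t := by simp [hδ]

lemma abs_integral_sub_le_of_osc {S : Type*} [MeasurableSpace S] {μ μ' : Measure S}
    [IsProbabilityMeasure μ] [IsProbabilityMeasure μ']
    {φ : S → ℝ} {δ t : ℝ} (hφ : Measurable φ) (ho : ∀ x y, φ x - φ y ≤ δ)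
    (ht : ∀ A, MeasurableSet A → |μ.real A - μ'.real A| ≤ t) :
    |∫ x, φ x ∂μ - ∫ x, φ x ∂μ'| ≤ δ * t := by
  refine abs_sub_le_iff.2 ⟨?_, ?_⟩
  · exact integral_sub_le_of_osc hφ ho fun A hA => (abs_sub_le_iff.1 (ht A hA)).1
  · exact integral_sub_le_of_osc hφ ho fun A hA => (abs_sub_le_iff.1 (ht A hA)).2

lemma abs_integral_sub_le_osc {S : Type*} [MeasurableSpace S] {μ μ' : Measure S}
    [IsProbabilityMeasure μ] [IsProbabilityMeasure μ']
    {φ : S → ℝ} {δ : ℝ} (hφ : Measurable φ) (ho : ∀ x y, φ x - φ y ≤ δ) :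
    |∫ x, φ x ∂μ - ∫ x, φ x ∂μ'| ≤ δ := by
  have h := abs_integral_sub_le_of_osc (μ := μ) (μ' := μ') hφ ho (t := 1) fun A _ => ?_
  · simpa using h
  · have h1 : μ.real A ≤ 1 := measureReal_le_one
    have h2 : μ'.real A ≤ 1 := measureReal_le_one
    have h3 : 0 ≤ μ.real A := measureReal_nonneg
    have h4 : 0 ≤ μ'.real A := measureReal_nonneg
    exact abs_sub_le_iff.2 ⟨by linarith, by linarith⟩

lemma integral_bind_kernel {S T : Type*} [MeasurableSpace S] [MeasurableSpace T]
    (π : Measure S) [IsProbabilityMeasure π] (K : Kernel S T) [IsMarkovKernel K]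
    {φ : T → ℝ} {δ : ℝ} (hφ : Measurable φ) (ho : ∀ x y, φ x - φ y ≤ δ) :
    ∫ z, φ z ∂(π.bind K) = ∫ p, ∫ z, φ z ∂(K p) ∂π := by
  rw [← Measure.snd_compProd, Measure.snd, integral_map measurable_snd.aemeasurable
    hφ.aestronglyMeasurable, Measure.integral_compProd]
  exact integrable_of_osc (hφ.comp measurable_snd) fun x y => ho x.2 y.2

end Oscillation

/-! ### The quadratic operator and its contraction -/

section DrawOp

variable (K : Kernel (C × C) C) [IsMarkovKernel K]

/-- The law of the colour `K (x, y)` produced by independent draws `x`, `y` of laws `μ`, `ν`. -/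
def drawOp (μ ν : ProbabilityMeasure C) : ProbabilityMeasure C :=
  ⟨((μ : Measure C).prod (ν : Measure C)).bind K, inferInstance⟩

lemma coe_drawOp (μ ν : ProbabilityMeasure C) :
    (drawOp K μ ν : Measure C) = ((μ : Measure C).prod (ν : Measure C)).bind K := rfl

lemma measurable_drawOp :
    Measurable fun p : ProbabilityMeasure C × ProbabilityMeasure C => drawOp K p.1 p.2 :=
  ((Measure.measurable_bind' K.measurable).comp
    ProbabilityMeasure.measurable_fun_prod).subtype_mk

variable {K}

lemma osc_integral_kernel {κ δ : ℝ}
    (hκ : ∀ p q A, MeasurableSet A → |(K p).real A - (K q).real A| ≤ κ)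
    {φ : C → ℝ} (hφ : Measurable φ) (ho : ∀ x y, φ x - φ y ≤ δ) (p q : C × C) :
    ∫ z, φ z ∂(K p) - ∫ z, φ z ∂(K q) ≤ δ * κ :=
  (le_abs_self _).trans (abs_integral_sub_le_of_osc hφ ho fun A hA => hκ p q A hA)

/-- Integrating out the draw in the second coordinate leaves a function of the first coordinate
whose oscillation is contracted by `κ`. -/
lemma exists_integral_drawOp_left {κ δ : ℝ}
    (hκ : ∀ p q A, MeasurableSet A → |(K p).real A - (K q).real A| ≤ κ)
    {φ : C → ℝ} (hφ : Measurable φ) (ho : ∀ x y, φ x - φ y ≤ δ) (ν : ProbabilityMeasure C) :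
    ∃ ψ : C → ℝ, Measurable ψ ∧ (∀ x y, ψ x - ψ y ≤ δ * κ) ∧
      ∀ μ : ProbabilityMeasure C,
        ∫ z, φ z ∂(drawOp K μ ν : Measure C) = ∫ x, ψ x ∂(μ : Measure C) := by
  have hm : StronglyMeasurable fun p => ∫ z, φ z ∂(K p) := hφ.stronglyMeasurable.integral_kernel
  have hosc := osc_integral_kernel hκ hφ ho
  have hi : ∀ x, Integrable (fun y => ∫ z, φ z ∂(K (x, y))) (ν : Measure C) := fun x =>
    integrable_of_osc (hm.measurable.comp measurable_prodMk_left) fun y y' => hosc _ _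
  refine ⟨fun x => ∫ y, ∫ z, φ z ∂(K (x, y)) ∂(ν : Measure C), hm.integral_prod_right.measurable,
    fun x x' => ?_, fun μ => ?_⟩
  · rw [← integral_sub (hi x) (hi x')]
    refine (integral_mono ((hi x).sub (hi x')) (integrable_const (δ * κ))
      fun y => hosc (x, y) (x', y)).trans ?_
    simp
  · rw [coe_drawOp, integral_bind_kernel _ K hφ ho, integral_prod]
    exact integrable_of_osc hm.measurable hosc

lemma exists_integral_drawOp_right {κ δ : ℝ}
    (hκ : ∀ p q A, MeasurableSet A → |(K p).real A - (K q).real A| ≤ κ)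
    {φ : C → ℝ} (hφ : Measurable φ) (ho : ∀ x y, φ x - φ y ≤ δ) (μ : ProbabilityMeasure C) :
    ∃ ψ : C → ℝ, Measurable ψ ∧ (∀ x y, ψ x - ψ y ≤ δ * κ) ∧
      ∀ ν : ProbabilityMeasure C,
        ∫ z, φ z ∂(drawOp K μ ν : Measure C) = ∫ x, ψ x ∂(ν : Measure C) := by
  have hm : StronglyMeasurable fun p => ∫ z, φ z ∂(K p) := hφ.stronglyMeasurable.integral_kernel
  have hosc := osc_integral_kernel hκ hφ ho
  have hi : ∀ y, Integrable (fun x => ∫ z, φ z ∂(K (x, y))) (μ : Measure C) := fun y =>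
    integrable_of_osc (hm.measurable.comp measurable_prodMk_right) fun x x' => hosc _ _
  refine ⟨fun y => ∫ x, ∫ z, φ z ∂(K (x, y)) ∂(μ : Measure C), hm.integral_prod_left'.measurable,
    fun y y' => ?_, fun ν => ?_⟩
  · rw [← integral_sub (hi y) (hi y')]
    refine (integral_mono ((hi y).sub (hi y')) (integrable_const (δ * κ))
      fun x => hosc (x, y) (x, y')).trans ?_
    simp
  · rw [coe_drawOp, integral_bind_kernel _ K hφ ho, integral_prod_symm]
    exact integrable_of_osc hm.measurable hosc

/-- The map `m ↦ drawOp K m m` contracts the total variation distance by `2 * κ`. -/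
lemma abs_drawOp_self_sub_le {κ t : ℝ}
    (hκ : ∀ p q A, MeasurableSet A → |(K p).real A - (K q).real A| ≤ κ)
    {μ μ' : ProbabilityMeasure C}
    (ht : ∀ A, MeasurableSet A → |(μ : Measure C).real A - (μ' : Measure C).real A| ≤ t)
    {A : Set C} (hA : MeasurableSet A) :
    |(drawOp K μ μ : Measure C).real A - (drawOp K μ' μ' : Measure C).real A| ≤ 2 * κ * t := by
  have hφ : Measurable (A.indicator (1 : C → ℝ)) := measurable_one.indicator hA
  have ho : ∀ x y, A.indicator (1 : C → ℝ) x - A.indicator (1 : C → ℝ) y ≤ 1 := by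
    intro x y
    by_cases hx : x ∈ A <;> by_cases hy : y ∈ A <;> simp [hx, hy]
  -- The intermediate point is `drawOp K μ' μ`: the parents are replaced one at a time, each at cost
  -- `κ * t`.
  obtain ⟨ψ, hψ, hψo, hψi⟩ := exists_integral_drawOp_left hκ hφ ho μ
  obtain ⟨χ, hχ, hχo, hχi⟩ := exists_integral_drawOp_right hκ hφ ho μ'
  have h1 := abs_integral_sub_le_of_osc hψ hψo ht
  have h2 := abs_integral_sub_le_of_osc hχ hχo ht
  rw [← hψi, ← hψi, integral_indicator_one hA, integral_indicator_one hA] at h1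
  rw [← hχi, ← hχi, integral_indicator_one hA, integral_indicator_one hA] at h2
  have := abs_sub_le ((drawOp K μ μ : Measure C).real A) ((drawOp K μ' μ : Measure C).real A)
    ((drawOp K μ' μ' : Measure C).real A)
  linarith

end DrawOp

/-! ### Existence and uniqueness of the fixed point -/

section FixedPoint

/-- Sequential completeness of the probability measures for the total variation distance. -/
lemma exists_probabilityMeasure_of_cauchy (u : ℕ → ProbabilityMeasure C) (e : ℕ → ℝ)
    (he : Tendsto e atTop (𝓝 0))
    (hu : ∀ n k A, MeasurableSet A →
      |(u n : Measure C).real A - (u (n + k) : Measure C).real A| ≤ e n) :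
    ∃ ν : ProbabilityMeasure C, ∀ n A, MeasurableSet A →
      |(u n : Measure C).real A - (ν : Measure C).real A| ≤ e n := by
  have hlim : ∀ A, ∃ l : ℝ, MeasurableSet A →
      Tendsto (fun n => (u n : Measure C).real A) atTop (𝓝 l) := by
    intro A
    by_cases hA : MeasurableSet A
    · have hc : CauchySeq fun n => (u n : Measure C).real A := by
        refine cauchySeq_of_le_tendsto_0 (fun N => 2 * e N) (fun n m N hn hm => ?_)
          (by simpa using he.const_mul 2)
        obtain ⟨a, rfl⟩ := Nat.exists_eq_add_of_le hn
        obtain ⟨b, rfl⟩ := Nat.exists_eq_add_of_le hm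
        have h1 := hu N a A hA
        have h2 := hu N b A hA
        rw [Real.dist_eq]
        rw [abs_sub_comm] at h1
        have := abs_sub_le ((u (N + a) : Measure C).real A) ((u N : Measure C).real A)
          ((u (N + b) : Measure C).real A)
        linarith
      obtain ⟨l, hl⟩ := cauchySeq_tendsto_of_complete hc
      exact ⟨l, fun _ => hl⟩
    · exact ⟨0, fun h => absurd h hA⟩
  choose L hL using hlim
  have hL0 : ∀ A, MeasurableSet A → 0 ≤ L A := fun A hA =>
    ge_of_tendsto' (hL A hA) fun n => measureReal_nonneg
  have hdist : ∀ n A, MeasurableSet A → |(u n : Measure C).real A - L A| ≤ e n := by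
    intro n A hA
    have h1 : Tendsto (fun k => (u (n + k) : Measure C).real A) atTop (𝓝 (L A)) := by
      simpa only [add_comm n] using (tendsto_add_atTop_iff_nat n).2 (hL A hA)
    exact le_of_tendsto' ((tendsto_const_nhds.sub h1).abs) fun k => hu n k A hA
  have hempty : L ∅ = 0 :=
    tendsto_nhds_unique (hL ∅ .empty) (by simp)
  have hsum : ∀ (f : ℕ → Set C), (∀ i, MeasurableSet (f i)) → Pairwise (Function.onFun Disjoint f) →
      ∀ N, L (⋃ i ∈ Finset.range N, f i) = ∑ i ∈ Finset.range N, L (f i) := by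
    intro f hf hd N
    have h1 : Tendsto (fun n => ∑ i ∈ Finset.range N, (u n : Measure C).real (f i)) atTop
        (𝓝 (∑ i ∈ Finset.range N, L (f i))) :=
      tendsto_finsetSum _ fun i _ => hL _ (hf i)
    refine tendsto_nhds_unique (hL _ (Finset.measurableSet_biUnion _ fun i _ => hf i))
      (h1.congr fun n => ?_)
    exact (measureReal_biUnion_finset (fun i _ j _ hij => hd hij) fun i _ => hf i).symm
  -- The bound `e n` is uniform over measurable sets, so countable additivity passes from one `u n`
  -- with `e n < ε / 3` to the setwise limit `L`.
  have hhas : ∀ (f : ℕ → Set C), (∀ i, MeasurableSet (f i)) → Pairwise (Function.onFun Disjoint f) →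
      HasSum (fun i => L (f i)) (L (⋃ i, f i)) := by
    intro f hf hd
    refine (hasSum_iff_tendsto_nat_of_nonneg (fun i => hL0 _ (hf i)) _).2 ?_
    rw [Metric.tendsto_atTop]
    intro ε hε
    obtain ⟨n, hn⟩ := (he.eventually (gt_mem_nhds (show (0 : ℝ) < ε / 3 by positivity))).exists
    have hU : Tendsto (fun N => ∑ i ∈ Finset.range N, (u n : Measure C).real (f i)) atTop
        (𝓝 ((u n : Measure C).real (⋃ i, f i))) := by
      refine (hasSum_iff_tendsto_nat_of_nonneg (fun i => measureReal_nonneg) _).1 ?_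
      have h := ENNReal.hasSum_toReal (f := fun i => (u n : Measure C) (f i)) ?_
      · rwa [← ENNReal.tsum_toReal_eq fun i => measure_ne_top _ _, ← measure_iUnion hd hf] at h
      · rw [← measure_iUnion hd hf]
        exact measure_ne_top _ _
    obtain ⟨N₀, hN₀⟩ := Metric.tendsto_atTop.1 hU (ε / 3) (by positivity)
    refine ⟨N₀, fun N hN => ?_⟩
    have h1 := hN₀ N hN
    rw [← measureReal_biUnion_finset (fun i _ j _ hij => hd hij) fun i _ => hf i,
      Real.dist_eq] at h1
    rw [← hsum f hf hd, Real.dist_eq]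
    have h2 := hdist n (⋃ i, f i) (MeasurableSet.iUnion hf)
    have h3 := hdist n (⋃ i ∈ Finset.range N, f i) (Finset.measurableSet_biUnion _ fun i _ => hf i)
    rw [abs_lt] at h1 ⊢
    rw [abs_le] at h2 h3
    constructor <;> linarith [h1.1, h1.2, h2.1, h2.2, h3.1, h3.2]
  let ν : Measure C := Measure.ofMeasurable (fun A _ => ENNReal.ofReal (L A)) (by simp [hempty])
    (fun f hf hd => by
      rw [← (hhas f hf hd).tsum_eq,
        ENNReal.ofReal_tsum_of_nonneg (fun i => hL0 _ (hf i)) (hhas f hf hd).summable])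
  have hν : ∀ A, MeasurableSet A → ν A = ENNReal.ofReal (L A) := fun A hA =>
    Measure.ofMeasurable_apply A hA
  have huniv : L Set.univ = 1 := tendsto_nhds_unique (hL _ .univ) (by simp)
  refine ⟨⟨ν, ⟨by rw [hν _ .univ, huniv, ENNReal.ofReal_one]⟩⟩, fun n A hA => ?_⟩
  have : ν.real A = L A := by rw [measureReal_def, hν A hA, ENNReal.toReal_ofReal (hL0 A hA)]
  simpa [this] using hdist n A hA

lemma ProbabilityMeasure.ext_of_real {μ ν : ProbabilityMeasure C}
    (h : ∀ A, MeasurableSet A → (μ : Measure C).real A = (ν : Measure C).real A) : μ = ν := by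
  refine Subtype.ext (Measure.ext fun A hA => ?_)
  have := h A hA
  rwa [measureReal_def, measureReal_def, ENNReal.toReal_eq_toReal_iff' (measure_ne_top _ _)
    (measure_ne_top _ _)] at this

lemma abs_real_sub_le_one (μ ν : ProbabilityMeasure C) (A : Set C) :
    |(μ : Measure C).real A - (ν : Measure C).real A| ≤ 1 := by
  have h1 : (μ : Measure C).real A ≤ 1 := measureReal_le_one
  have h2 : (ν : Measure C).real A ≤ 1 := measureReal_le_one
  have h3 : 0 ≤ (μ : Measure C).real A := measureReal_nonneg
  have h4 : 0 ≤ (ν : Measure C).real A := measureReal_nonneg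
  exact abs_sub_le_iff.2 ⟨by linarith, by linarith⟩

variable {K : Kernel (C × C) C} [IsMarkovKernel K] {κ : ℝ}

lemma abs_drawOp_self_iterate_sub_le
    (hκ : ∀ p q A, MeasurableSet A → |(K p).real A - (K q).real A| ≤ κ)
    (μ ν : ProbabilityMeasure C) (n : ℕ) : ∀ A, MeasurableSet A →
      |(((fun m => drawOp K m m)^[n] μ : ProbabilityMeasure C) : Measure C).real A -
        (((fun m => drawOp K m m)^[n] ν : ProbabilityMeasure C) : Measure C).real A|
        ≤ (2 * κ) ^ n := by
  induction n with
  | zero => intro A _; simpa using abs_real_sub_le_one μ ν A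
  | succ n ih =>
    intro A hA
    rw [Function.iterate_succ_apply', Function.iterate_succ_apply', pow_succ']
    exact abs_drawOp_self_sub_le hκ ih hA

lemma drawOp_fixed_unique (hκ : ∀ p q A, MeasurableSet A → |(K p).real A - (K q).real A| ≤ κ)
    (h0 : 0 ≤ κ) (h1 : 2 * κ < 1) {μ ν : ProbabilityMeasure C} (hμ : drawOp K μ μ = μ)
    (hν : drawOp K ν ν = ν) : μ = ν := by
  refine ProbabilityMeasure.ext_of_real fun A hA => ?_
  have h := fun n => abs_drawOp_self_iterate_sub_le hκ μ ν n A hA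
  simp_rw [Function.iterate_fixed (f := fun m => drawOp K m m) hμ,
    Function.iterate_fixed (f := fun m => drawOp K m m) hν] at h
  have := ge_of_tendsto' (tendsto_pow_atTop_nhds_zero_of_lt_one (by positivity) h1) h
  exact sub_eq_zero.1 (abs_eq_zero.1 (le_antisymm this (abs_nonneg _)))

/-- Banach's iteration from a Dirac mass. The iterate `n + k` is the `n`-th iterate from another
starting point, so the contraction bound is at once a Cauchy bound. -/
lemma exists_drawOp_fixed [Nonempty C]
    (hκ : ∀ p q A, MeasurableSet A → |(K p).real A - (K q).real A| ≤ κ)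
    (h0 : 0 ≤ κ) (h1 : 2 * κ < 1) : ∃ ν : ProbabilityMeasure C, drawOp K ν ν = ν := by
  let μ₀ : ProbabilityMeasure C := ⟨Measure.dirac (Classical.arbitrary C), inferInstance⟩
  have he : Tendsto (fun n => (2 * κ) ^ n) atTop (𝓝 0) :=
    tendsto_pow_atTop_nhds_zero_of_lt_one (by positivity) h1
  obtain ⟨ν, hν⟩ := exists_probabilityMeasure_of_cauchy
    (fun n => (fun m => drawOp K m m)^[n] μ₀) (fun n => (2 * κ) ^ n) he (fun n k A hA => by
      rw [Function.iterate_add_apply]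
      exact abs_drawOp_self_iterate_sub_le hκ _ _ n A hA)
  refine ⟨ν, ProbabilityMeasure.ext_of_real fun A hA => ?_⟩
  -- The comparison goes through iterate `n + 1`; its distances to `drawOp K ν ν` (contraction) and
  -- to `ν` (limit) are each at most `(2 * κ) ^ (n + 1)`.
  have h : ∀ n, |(drawOp K ν ν : Measure C).real A - (ν : Measure C).real A| ≤
      2 * (2 * κ) ^ (n + 1) := by
    intro n
    have h2 := abs_drawOp_self_sub_le hκ (hν n) hA
    have h3 := hν (n + 1) A hA
    simp only [Function.iterate_succ_apply'] at h3
    rw [abs_sub_comm] at h2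
    rw [← pow_succ'] at h2
    have := abs_sub_le ((drawOp K ν ν : Measure C).real A)
      ((drawOp K ((fun m => drawOp K m m)^[n] μ₀) ((fun m => drawOp K m m)^[n] μ₀) :
        Measure C).real A) ((ν : Measure C).real A)
    linarith
  have := ge_of_tendsto' (((tendsto_add_atTop_iff_nat 1).2 he).const_mul 2) h
  rw [mul_zero] at this
  exact sub_eq_zero.1 (abs_eq_zero.1 (le_antisymm this (abs_nonneg _)))

end FixedPoint

/-! ### Multi-affine functionals and their splittings -/

section MultiAffine

variable {ι : Type*} [DecidableEq ι]

/-- `Φ` is, in each coordinate separately, the integral of a measurable function of oscillation at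
most `δ i` against the measure in that coordinate. -/
structure IsMultiAffine (Φ : (ι → ProbabilityMeasure C) → ℝ) (δ : ι → ℝ) : Prop where
  measurable : Measurable Φ
  exists_integral : ∀ i μ, ∃ φ : C → ℝ, Measurable φ ∧ (∀ x y, φ x - φ y ≤ δ i) ∧
    ∀ l : ProbabilityMeasure C, Φ (Function.update μ i l) = ∫ x, φ x ∂(l : Measure C)

namespace IsMultiAffine

variable {Φ : (ι → ProbabilityMeasure C) → ℝ} {δ : ι → ℝ}

lemma abs_update_sub_le (h : IsMultiAffine Φ δ) (i : ι) (μ : ι → ProbabilityMeasure C)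
    (l l' : ProbabilityMeasure C) :
    |Φ (Function.update μ i l) - Φ (Function.update μ i l')| ≤ δ i := by
  obtain ⟨φ, hφ, ho, hi⟩ := h.exists_integral i μ
  rw [hi, hi]
  exact abs_integral_sub_le_osc hφ ho

lemma osc_nonneg [Nonempty C] (h : IsMultiAffine Φ δ) (i : ι) : 0 ≤ δ i := by
  obtain ⟨φ, -, ho, -⟩ := h.exists_integral i
    fun _ => ⟨Measure.dirac (Classical.arbitrary C), inferInstance⟩
  simpa using ho (Classical.arbitrary C) (Classical.arbitrary C)

lemma update_mix (h : IsMultiAffine Φ δ) {γ : ℝ} (h0 : 0 ≤ γ) (h1 : γ ≤ 1)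
    {m m' l : ProbabilityMeasure C}
    (hm : (m' : Measure C) = ENNReal.ofReal (1 - γ) • (m : Measure C) +
      ENNReal.ofReal γ • (l : Measure C)) (i : ι) (μ : ι → ProbabilityMeasure C) :
    Φ (Function.update μ i m') =
      (1 - γ) * Φ (Function.update μ i m) + γ * Φ (Function.update μ i l) := by
  obtain ⟨φ, hφ, ho, hi⟩ := h.exists_integral i μ
  rw [hi, hi, hi, hm, integral_add_measure, integral_smul_measure, integral_smul_measure,
    ENNReal.toReal_ofReal (sub_nonneg.2 h1), ENNReal.toReal_ofReal h0, smul_eq_mul, smul_eq_mul]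
  · exact (integrable_of_osc hφ ho).smul_measure ENNReal.ofReal_ne_top
  · exact (integrable_of_osc hφ ho).smul_measure ENNReal.ofReal_ne_top

end IsMultiAffine

/-- Telescoping over the coordinates in `s`, changed one at a time. -/
lemma abs_piecewise_sub_le {E : Type*} {Φ : (ι → E) → ℝ} {d : ι → ℝ} {μ μ' : ι → E}
    (s : Finset ι)
    (hd : ∀ i ∈ s, ∀ ξ, |Φ (Function.update ξ i (μ i)) - Φ (Function.update ξ i (μ' i))| ≤ d i) :
    |Φ (s.piecewise μ μ') - Φ μ'| ≤ ∑ i ∈ s, d i := by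
  induction s using Finset.induction_on with
  | empty => simp
  | insert i s his ih =>
    have h1 := hd i (Finset.mem_insert_self i s) (s.piecewise μ μ')
    have h2 : Function.update (s.piecewise μ μ') i (μ' i) = s.piecewise μ μ' := by
      rw [Function.update_eq_self_iff, Finset.piecewise_eq_of_notMem _ _ _ his]
    rw [h2] at h1
    rw [Finset.piecewise_insert, Finset.sum_insert his]
    exact (abs_sub_le _ (Φ (s.piecewise μ μ')) _).trans (add_le_add h1
      (ih fun k hk => hd k (Finset.mem_insert_of_mem hk)))

namespace IsMultiAffine

variable {Φ : (ι → ProbabilityMeasure C) → ℝ} {δ : ι → ℝ}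

lemma abs_sub_le [Fintype ι] (h : IsMultiAffine Φ δ) (μ μ' : ι → ProbabilityMeasure C) :
    |Φ μ - Φ μ'| ≤ ∑ i, δ i := by
  have := abs_piecewise_sub_le (Φ := Φ) (μ := μ) (μ' := μ')
    Finset.univ fun i _ ξ => h.abs_update_sub_le i ξ (μ i) (μ' i)
  rwa [Finset.piecewise_univ] at this

/-- First order expansion of a multi-affine functional on the diagonal along a mixture. -/
lemma abs_diag_mix_sub_le [Fintype ι] [Nonempty C] (h : IsMultiAffine Φ δ) {γ : ℝ} (h0 : 0 ≤ γ)
    (h1 : γ ≤ 1) {m m' l : ProbabilityMeasure C}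
    (hm : (m' : Measure C) = ENNReal.ofReal (1 - γ) • (m : Measure C) +
      ENNReal.ofReal γ • (l : Measure C)) :
    |Φ (fun _ => m') - Φ (fun _ => m) -
        γ * ∑ i, (Φ (Function.update (fun _ => m) i l) - Φ (fun _ => m))|
      ≤ Fintype.card ι * (2 * γ ^ 2 * ∑ i, δ i) := by
  have hchange : ∀ i ξ, |Φ (Function.update ξ i m') - Φ (Function.update ξ i m)| ≤ γ * δ i := by
    intro i ξ
    have h2 := h.abs_update_sub_le i ξ l m
    rw [h.update_mix h0 h1 hm,
      show (1 - γ) * Φ (Function.update ξ i m) + γ * Φ (Function.update ξ i l) -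
        Φ (Function.update ξ i m) =
        γ * (Φ (Function.update ξ i l) - Φ (Function.update ξ i m)) by ring, abs_mul,
      abs_of_nonneg h0]
    exact mul_le_mul_of_nonneg_left h2 h0
  have hsub : ∀ s : Finset ι, ∑ i ∈ s, γ * δ i ≤ γ * ∑ i, δ i := fun s => by
    rw [← Finset.mul_sum]
    exact mul_le_mul_of_nonneg_left
      (Finset.sum_le_univ_sum_of_nonneg fun i => h.osc_nonneg i) h0
  -- Induction on the set of coordinates already moved to `m'`. By affinity one more coordinate adds
  -- γ times a difference at the partly moved point `ξ`. Evaluating it at the diagonal instead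
  -- perturbs each of its two terms by at most `γ * ∑ i, δ i`, whence the error `2 * γ ^ 2 * ∑ i, δ
  -- i` per coordinate.
  have key : ∀ s : Finset ι,
      |Φ (s.piecewise (fun _ => m') (fun _ => m)) - Φ (fun _ => m) -
        γ * ∑ i ∈ s, (Φ (Function.update (fun _ => m) i l) - Φ (fun _ => m))|
      ≤ s.card * (2 * γ ^ 2 * ∑ i, δ i) := by
    intro s
    induction s using Finset.induction_on with
    | empty => simp
    | insert i s his ih =>
      set ξ : ι → ProbabilityMeasure C := s.piecewise (fun _ => m') (fun _ => m) with hξ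
      have e1 : Function.update ξ i m = ξ := by
        rw [Function.update_eq_self_iff, hξ, Finset.piecewise_eq_of_notMem _ _ _ his]
      have b1 : |Φ ξ - Φ (fun _ => m)| ≤ γ * ∑ i, δ i :=
        (abs_piecewise_sub_le (Φ := Φ) s fun k _ => hchange k).trans (hsub s)
      have b2 : |Φ (Function.update ξ i l) - Φ (Function.update (fun _ => m) i l)| ≤
          γ * ∑ i, δ i := by
        rw [hξ, s.update_piecewise_of_notMem _ _ his]
        refine (abs_piecewise_sub_le (Φ := Φ) (d := fun i => γ * δ i) s fun k hk ζ => ?_).trans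
          (hsub s)
        simpa [ne_of_mem_of_not_mem hk his] using hchange k ζ
      rw [Finset.piecewise_insert, Finset.sum_insert his, Finset.card_insert_of_notMem his,
        h.update_mix h0 h1 hm, e1]
      have b3 : |γ * ((Φ (Function.update ξ i l) - Φ (Function.update (fun _ => m) i l)) -
          (Φ ξ - Φ (fun _ => m)))| ≤ γ * (γ * ∑ i, δ i + γ * ∑ i, δ i) := by
        rw [abs_mul, abs_of_nonneg h0]
        exact mul_le_mul_of_nonneg_left ((abs_sub _ _).trans (add_le_add b2 b1)) h0
      have b4 := (abs_add_le _ _).trans (add_le_add ih b3)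
      push_cast
      refine le_trans (le_of_eq ?_) (b4.trans (le_of_eq ?_))
      · congr 1
        ring
      · ring
  have := key Finset.univ
  rwa [Finset.piecewise_univ] at this

end IsMultiAffine

variable (K : Kernel (C × C) C) [IsMarkovKernel K]

/-- The functional obtained from `Φ` by feeding into its coordinate `i` the colour drawn from two
independent parents. -/
def splitAt (Φ : (ι → ProbabilityMeasure C) → ℝ) (i : ι) :
    (Option ι → ProbabilityMeasure C) → ℝ := fun μ =>
  Φ (Function.update (fun k => μ (some k)) i (drawOp K (μ (some i)) (μ none)))

/-- The bounds on the oscillations of `splitAt K Φ i`. -/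
def splitOsc (κ : ℝ) (δ : ι → ℝ) (i : ι) : Option ι → ℝ
  | none => δ i * κ
  | some k => Function.update δ i (δ i * κ) k

variable {K}

/-- The source of the gain: an oscillation `δ i` is traded for two oscillations `δ i * κ`, one per
parent. -/
lemma sum_splitOsc [Fintype ι] (κ : ℝ) (δ : ι → ℝ) (i : ι) :
    ∑ o, splitOsc κ δ i o = ∑ k, δ k - (1 - 2 * κ) * δ i := by
  rw [Fintype.sum_option]
  simp only [splitOsc]
  rw [Finset.sum_update_of_mem (Finset.mem_univ i), Finset.sum_eq_add_sum_sdiff_singleton_of_mem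
    (Finset.mem_univ i) δ]
  ring

/-- In the two parent coordinates the integrand is the one of `Φ` at `i`, pulled back through a draw
and hence contracted by `κ`; every other coordinate keeps its integrand from `Φ`. -/
lemma IsMultiAffine.splitAt {Φ : (ι → ProbabilityMeasure C) → ℝ} {δ : ι → ℝ} {κ : ℝ}
    (hκ : ∀ p q A, MeasurableSet A → |(K p).real A - (K q).real A| ≤ κ)
    (h : IsMultiAffine Φ δ) (i : ι) : IsMultiAffine (splitAt K Φ i) (splitOsc κ δ i) where
  measurable := by
    refine h.measurable.comp (measurable_pi_lambda _ fun k => ?_)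
    by_cases hk : k = i
    · subst hk
      have hp : Measurable fun μ : Option ι → ProbabilityMeasure C => (μ (some k), μ none) :=
        (measurable_pi_apply (some k)).prodMk (measurable_pi_apply none)
      simpa only [Function.update_self] using! (measurable_drawOp K).comp hp
    · simp only [Function.update_of_ne hk]
      exact measurable_pi_apply (some k)
  exists_integral := by
    rintro (_ | k) μ
    · obtain ⟨φ, hφ, ho, hi⟩ := h.exists_integral i fun k => μ (some k)
      obtain ⟨ψ, hψ, hψo, hψi⟩ := exists_integral_drawOp_right hκ hφ ho (μ (some i))
      refine ⟨ψ, hψ, hψo, fun l => ?_⟩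
      rw [← hψi, ← hi]
      simp [PolyaUrn.splitAt]
    · by_cases hk : k = i
      · subst hk
        obtain ⟨φ, hφ, ho, hi⟩ := h.exists_integral k fun k => μ (some k)
        obtain ⟨ψ, hψ, hψo, hψi⟩ := exists_integral_drawOp_left hκ hφ ho (μ none)
        refine ⟨ψ, hψ, by simpa [splitOsc] using hψo, fun l => ?_⟩
        rw [← hψi, ← hi]
        simp only [PolyaUrn.splitAt, Function.update_self]
        congr 1
        funext j
        by_cases hj : j = k
        · subst hj; simp
        · simp [hj]
      · obtain ⟨φ, hφ, ho, hi⟩ := h.exists_integral k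
          (Function.update (fun k => μ (some k)) i (drawOp K (μ (some i)) (μ none)))
        refine ⟨φ, hφ, by simpa [splitOsc, hk] using ho, fun l => ?_⟩
        rw [← hi]
        simp only [PolyaUrn.splitAt]
        congr 1
        funext j
        by_cases hj : j = i
        · subst hj; simp [Ne.symm hk]
        · by_cases hjk : j = k
          · subst hjk; simp [hj]
          · simp [hj, hjk]

end MultiAffine

/-! ### Relaxation of real sequences -/

section Sequences

/-- A sequence relaxing towards `b` with non-summable rates is eventually at most `b + ε`. -/
lemma eventually_le_of_relaxation {u s : ℕ → ℝ} {b : ℝ} (hs0 : ∀ n, 0 ≤ s n)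
    (hs1 : ∀ᶠ n in atTop, s n ≤ 1) (hs : ¬ Summable s)
    (hu : ∀ᶠ n in atTop, u (n + 1) ≤ (1 - s n) * u n + s n * b) {ε : ℝ} (hε : 0 < ε) :
    ∀ᶠ n in atTop, u n ≤ b + ε := by
  obtain ⟨N, hN⟩ := eventually_atTop.1 (hs1.and hu)
  -- The product of the factors `1 - s` is bounded by the exponential of minus their sum, which
  -- diverges.
  have key : ∀ k, u (k + N) - b ≤
      Real.exp (-∑ i ∈ Finset.range k, s (i + N)) * |u N - b| := by
    intro k
    induction k with
    | zero => simpa using le_abs_self (u N - b)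
    | succ k ih =>
      obtain ⟨h1, h2⟩ := hN (k + N) (Nat.le_add_left _ _)
      rw [Finset.sum_range_succ, neg_add, Real.exp_add, add_right_comm k 1 N]
      have h3 : 1 - s (k + N) ≤ Real.exp (-s (k + N)) := by
        linarith [Real.add_one_le_exp (-s (k + N))]
      calc u (k + N + 1) - b ≤ (1 - s (k + N)) * (u (k + N) - b) := by linarith
        _ ≤ (1 - s (k + N)) * (Real.exp (-∑ i ∈ Finset.range k, s (i + N)) * |u N - b|) :=
          mul_le_mul_of_nonneg_left ih (by linarith)
        _ ≤ Real.exp (-s (k + N)) * (Real.exp (-∑ i ∈ Finset.range k, s (i + N)) * |u N - b|) :=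
          mul_le_mul_of_nonneg_right h3 (by positivity)
        _ = _ := by ring
  have hsum : Tendsto (fun k => ∑ i ∈ Finset.range k, s (i + N)) atTop atTop :=
    (not_summable_iff_tendsto_nat_atTop_of_nonneg fun n => hs0 _).1
      fun h => hs ((summable_nat_add_iff N).1 h)
  have hlim : Tendsto (fun k => Real.exp (-∑ i ∈ Finset.range k, s (i + N)) * |u N - b|) atTop
      (𝓝 (0 * |u N - b|)) :=
    (Real.tendsto_exp_neg_atTop_nhds_zero.comp hsum).mul_const _
  rw [zero_mul] at hlim
  have hev : ∀ᶠ k in atTop, u (k + N) ≤ b + ε := by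
    filter_upwards [hlim.eventually (gt_mem_nhds hε)] with k hk
    linarith [key k]
  obtain ⟨M, hM⟩ := eventually_atTop.1 hev
  refine eventually_atTop.2 ⟨M + N, fun n hn => ?_⟩
  obtain ⟨k, rfl⟩ := Nat.exists_eq_add_of_le' (show N ≤ n by omega)
  exact hM k (by omega)

lemma not_summable_const_div_add {c a b : ℝ} (hc : 0 < c) (ha : 0 < a) (hb : 0 ≤ b) :
    ¬ Summable fun n : ℕ => c / (a * n + b) := by
  intro h
  have h2 : Summable fun n : ℕ => ((a + b) / c) * (c / (a * ((n + 1 : ℕ) : ℝ) + b)) :=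
    ((summable_nat_add_iff 1).2 h).mul_left _
  refine Real.not_summable_natCast_inv ((summable_nat_add_iff 1).1
    (Summable.of_nonneg_of_le (fun n => by positivity) (fun n => ?_) h2))
  have hn : (0 : ℝ) < ((n + 1 : ℕ) : ℝ) := by positivity
  have hn1 : (1 : ℝ) ≤ ((n + 1 : ℕ) : ℝ) := by push_cast; linarith [Nat.cast_nonneg (α := ℝ) n]
  rw [div_mul_div_cancel₀ hc.ne', inv_eq_one_div, div_le_div_iff₀ hn (by positivity)]
  nlinarith

end Sequences

/-! ### One step of the urn -/

section Urn

/-- The law of two independent draws from a probability measure, as a kernel. -/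
def pairKernel (C : Type*) [MeasurableSpace C] : Kernel (ProbabilityMeasure C) (C × C) where
  toFun m := (m : Measure C).prod (m : Measure C)
  measurable' := ProbabilityMeasure.measurable_fun_prod.comp (measurable_id.prodMk measurable_id)

lemma pairKernel_apply (m : ProbabilityMeasure C) :
    pairKernel C m = (m : Measure C).prod (m : Measure C) := rfl

instance : IsMarkovKernel (pairKernel C) :=
  ⟨fun m => by rw [pairKernel_apply]; infer_instance⟩

/-- A Markov kernel as a function into the probability measures. -/
def kernelProb (K : Kernel (C × C) C) [IsMarkovKernel K] (p : C × C) : ProbabilityMeasure C :=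
  ⟨K p, inferInstance⟩

lemma measurable_kernelProb (K : Kernel (C × C) C) [IsMarkovKernel K] :
    Measurable (kernelProb K) :=
  K.measurable.subtype_mk

/-- The composition process of a two-drawing urn: `M (n + 1)` is a mixture, with weight `γ n` on the
new colour, of `M n` and of `K (X n)`, where `X n` is a pair of independent draws from `M n`. -/
structure IsUrn {Ω : Type*} [MeasurableSpace Ω] (P : Measure Ω) (K : Kernel (C × C) C)
    [IsMarkovKernel K] (M : ℕ → Ω → ProbabilityMeasure C) (X : ℕ → Ω → C × C) (γ : ℕ → ℝ) :
    Prop where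
  measurable : ∀ n, Measurable (M n)
  measurable_draw : ∀ n, Measurable (X n)
  map_draw : ∀ n, P.map (fun ω => (M n ω, X n ω)) = (P.map (M n)) ⊗ₘ (pairKernel C)
  mix : ∀ n ω, (M (n + 1) ω : Measure C) = ENNReal.ofReal (1 - γ n) • (M n ω : Measure C) +
    ENNReal.ofReal (γ n) • (kernelProb K (X n ω) : Measure C)

lemma measurable_diag {ι : Type*} : Measurable fun (m : ProbabilityMeasure C) (_ : ι) => m :=
  measurable_pi_lambda _ fun _ => measurable_id

lemma measurable_update_diag {ι : Type*} [DecidableEq ι] (i : ι) : Measurable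
    fun p : ProbabilityMeasure C × ProbabilityMeasure C => Function.update (fun _ => p.1) i p.2 := by
  refine measurable_pi_lambda _ fun k => ?_
  by_cases hk : k = i
  · subst hk
    simpa using measurable_snd
  · simpa [hk] using measurable_fst

variable {Ω : Type*} [MeasurableSpace Ω] {P : Measure Ω} [IsProbabilityMeasure P]
  {K : Kernel (C × C) C} [IsMarkovKernel K] {M : ℕ → Ω → ProbabilityMeasure C}
  {X : ℕ → Ω → C × C} {γ : ℕ → ℝ}

variable {ι : Type*} [DecidableEq ι] [Fintype ι] {Φ : (ι → ProbabilityMeasure C) → ℝ} {δ : ι → ℝ}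

lemma IsMultiAffine.integrable_comp (h : IsMultiAffine Φ δ) {f : Ω → ι → ProbabilityMeasure C}
    (hf : Measurable f) : Integrable (fun ω => Φ (f ω)) P :=
  integrable_of_osc (h.measurable.comp hf) fun _ _ => (le_abs_self _).trans (h.abs_sub_le _ _)

/-- Replacing one coordinate by the new colour has, on average, the effect of splitting it. -/
lemma IsUrn.integral_update (hU : IsUrn P K M X γ) (h : IsMultiAffine Φ δ) (i : ι) (n : ℕ) :
    ∫ ω, Φ (Function.update (fun _ => M n ω) i (kernelProb K (X n ω))) ∂P =
      ∫ ω, splitAt K Φ i (fun _ => M n ω) ∂P := by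
  have hg : Measurable fun p : ProbabilityMeasure C × (C × C) =>
      Function.update (fun _ : ι => p.1) i (kernelProb K p.2) :=
    (measurable_update_diag i).comp
      (measurable_fst.prodMk ((measurable_kernelProb K).comp measurable_snd))
  have hΦ : Measurable fun p : ProbabilityMeasure C × (C × C) =>
      Φ (Function.update (fun _ : ι => p.1) i (kernelProb K p.2)) := h.measurable.comp hg
  have hpair : Measurable fun ω => (M n ω, X n ω) :=
    (hU.measurable n).prodMk (hU.measurable_draw n)
  have e1 := integral_map (μ := P) hpair.aemeasurable hΦ.aestronglyMeasurable
  have : IsProbabilityMeasure (P.map (M n)) :=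
    Measure.isProbabilityMeasure_map (hU.measurable n).aemeasurable
  rw [hU.map_draw n, Measure.integral_compProd (h.integrable_comp hg)] at e1
  -- Given the composition `m`, averaging `K x` over the drawn pair gives `drawOp K m m`, and `Φ` is
  -- affine in coordinate `i`.
  have e2 : ∀ m : ProbabilityMeasure C,
      ∫ x, Φ (Function.update (fun _ => m) i (kernelProb K x)) ∂(pairKernel C m) =
        splitAt K Φ i (fun _ => m) := by
    intro m
    obtain ⟨φ, hφ, ho, hi⟩ := h.exists_integral i fun _ => m
    simp only [splitAt, hi]
    rw [coe_drawOp, integral_bind_kernel _ K hφ ho]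
    rfl
  have hs : Measurable fun m : ProbabilityMeasure C => splitAt K Φ i (fun _ => m) :=
    h.measurable.comp ((measurable_update_diag i).comp
      (measurable_id.prodMk ((measurable_drawOp K).comp (measurable_id.prodMk measurable_id))))
  simp only [e2] at e1
  rw [← e1, integral_map (hU.measurable n).aemeasurable hs.aestronglyMeasurable]

/-- The one-step recursion of the mean of a multi-affine functional along an urn. -/
lemma IsUrn.abs_integral_succ_sub_le [Nonempty C] (hU : IsUrn P K M X γ) (h : IsMultiAffine Φ δ)
    {n : ℕ} (h0 : 0 ≤ γ n) (h1 : γ n ≤ 1) :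
    |∫ ω, Φ (fun _ => M (n + 1) ω) ∂P - ∫ ω, Φ (fun _ => M n ω) ∂P -
        γ n * ∑ i, (∫ ω, splitAt K Φ i (fun _ => M n ω) ∂P - ∫ ω, Φ (fun _ => M n ω) ∂P)|
      ≤ Fintype.card ι * (2 * γ n ^ 2 * ∑ i, δ i) := by
  have hd : ∀ k, Integrable (fun ω => Φ (fun _ => M k ω)) P := fun k =>
    h.integrable_comp (measurable_diag.comp (hU.measurable k))
  have hu : ∀ i, Integrable
      (fun ω => Φ (Function.update (fun _ => M n ω) i (kernelProb K (X n ω)))) P := fun i =>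
    h.integrable_comp ((measurable_update_diag i).comp
      ((hU.measurable n).prodMk ((measurable_kernelProb K).comp (hU.measurable_draw n))))
  have hud : ∀ i, Integrable (fun ω =>
      Φ (Function.update (fun _ => M n ω) i (kernelProb K (X n ω))) - Φ (fun _ => M n ω)) P :=
    fun i => (hu i).sub (hd n)
  have hsum : Integrable (fun ω => ∑ i,
      (Φ (Function.update (fun _ => M n ω) i (kernelProb K (X n ω))) - Φ (fun _ => M n ω))) P :=
    integrable_finsetSum _ fun i _ => hud i
  simp_rw [← hU.integral_update h]
  have e : ∫ ω, Φ (fun _ => M (n + 1) ω) ∂P - ∫ ω, Φ (fun _ => M n ω) ∂P -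
        γ n * ∑ i, (∫ ω, Φ (Function.update (fun _ => M n ω) i (kernelProb K (X n ω))) ∂P -
          ∫ ω, Φ (fun _ => M n ω) ∂P) =
      ∫ ω, (Φ (fun _ => M (n + 1) ω) - Φ (fun _ => M n ω) - γ n * ∑ i,
        (Φ (Function.update (fun _ => M n ω) i (kernelProb K (X n ω))) -
          Φ (fun _ => M n ω))) ∂P := by
    have hd2 : Integrable (fun ω => Φ (fun _ => M (n + 1) ω) - Φ (fun _ => M n ω)) P :=
      (hd (n + 1)).sub (hd n)
    rw [integral_sub hd2 (hsum.const_mul _),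
      integral_sub (hd (n + 1)) (hd n), integral_const_mul,
      integral_finsetSum _ fun i _ => hud i]
    simp_rw [integral_sub (hu _) (hd n)]
  rw [e, ← Real.norm_eq_abs]
  refine (norm_integral_le_of_norm_le_const (Eventually.of_forall fun ω =>
    h.abs_diag_mix_sub_le h0 h1 (hU.mix n ω))).trans_eq ?_
  simp

end Urn

/-! ### Convergence of means of multi-affine functionals -/

section Convergence

variable {Ω : Type*} [MeasurableSpace Ω] {P : Measure Ω} [IsProbabilityMeasure P]
  {K : Kernel (C × C) C} [IsMarkovKernel K] {M : ℕ → Ω → ProbabilityMeasure C}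
  {X : ℕ → Ω → C × C} {γ : ℕ → ℝ} {κ : ℝ} {ν : ProbabilityMeasure C}

/-- If the splittings of `Φ` are asymptotically within `w` times their oscillation of their value at
`ν`, then so is `Φ`, with the better constant `w * (1 - (1 - 2 * κ) / j)`. -/
lemma IsUrn.eventually_le_of_splitAt [Nonempty C] {ι : Type*} [DecidableEq ι] [Fintype ι]
    [Nonempty ι] {Φ : (ι → ProbabilityMeasure C) → ℝ} {δ : ι → ℝ}
    (hU : IsUrn P K M X γ) (hγ0 : ∀ n, 0 ≤ γ n) (hγ : Tendsto γ atTop (𝓝 0)) (hγs : ¬ Summable γ)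
    (hν : drawOp K ν ν = ν) (h : IsMultiAffine Φ δ) {w : ℝ}
    (hw : ∀ i, ∀ ε > 0, ∀ᶠ n in atTop,
      |∫ ω, splitAt K Φ i (fun _ => M n ω) ∂P - splitAt K Φ i (fun _ => ν)| ≤
        w * ∑ o, splitOsc κ δ i o + ε) {ε : ℝ} (hε : 0 < ε) :
    ∀ᶠ n in atTop, |∫ ω, Φ (fun _ => M n ω) ∂P - Φ (fun _ => ν)| ≤
      w * (1 - (1 - 2 * κ) / Fintype.card ι) * ∑ i, δ i + ε := by
  set j : ℝ := (Fintype.card ι : ℝ) with hj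
  have hj0 : 0 < j := Nat.cast_pos.2 Fintype.card_pos
  set D := ∑ i, δ i with hD
  set c := Φ (fun _ => ν) with hc
  have hsplit : ∀ i, splitAt K Φ i (fun _ => ν) = c := fun i => by
    simp only [splitAt, hν, Function.update_eq_self, hc]
  simp_rw [hsplit, sum_splitOsc] at hw
  have hev : ∀ᶠ n in atTop, ∀ i, |∫ ω, splitAt K Φ i (fun _ => M n ω) ∂P - c| ≤
      w * (D - (1 - 2 * κ) * δ i) + ε / 3 :=
    eventually_all.2 fun i => hw i (ε / 3) (by positivity)
  have hjγ : Tendsto (fun n => j * γ n) atTop (𝓝 0) := by simpa using hγ.const_mul j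
  have hDγ : Tendsto (fun n => 2 * D * γ n) atTop (𝓝 0) := by simpa using hγ.const_mul (2 * D)
  -- Relaxation at rate `j * γ n`. Averaging the bounds `w * (D - (1 - 2 * κ) * δ i)` over the `j`
  -- coordinates produces the target; one `ε / 3` comes from `hev`, the other absorbs the
  -- second-order error.
  have hrel : ∀ᶠ n in atTop, |∫ ω, Φ (fun _ => M (n + 1) ω) ∂P - c| ≤
      (1 - j * γ n) * |∫ ω, Φ (fun _ => M n ω) ∂P - c| +
        j * γ n * (w * (1 - (1 - 2 * κ) / j) * D + 2 * (ε / 3)) := by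
    filter_upwards [hev, hγ.eventually (ge_mem_nhds one_pos),
      hjγ.eventually (ge_mem_nhds one_pos),
      hDγ.eventually (ge_mem_nhds (show 0 < ε / 3 by positivity))]
      with n hn hn1 hn2 hn3
    have hstep := hU.abs_integral_succ_sub_le h (hγ0 n) hn1
    set a := ∫ ω, Φ (fun _ => M n ω) ∂P with ha
    set a' := ∫ ω, Φ (fun _ => M (n + 1) ω) ∂P with ha'
    have e : a' - c = (a' - a - γ n * ∑ i, (∫ ω, splitAt K Φ i (fun _ => M n ω) ∂P - a)) +
        ((1 - j * γ n) * (a - c) +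
          γ n * ∑ i, (∫ ω, splitAt K Φ i (fun _ => M n ω) ∂P - c)) := by
      simp only [Finset.sum_sub_distrib, Finset.sum_const, Finset.card_univ, nsmul_eq_mul, ← hj]
      ring
    have b1 : |(1 - j * γ n) * (a - c)| = (1 - j * γ n) * |a - c| := by
      rw [abs_mul, abs_of_nonneg (by linarith)]
    have b2 : |γ n * ∑ i, (∫ ω, splitAt K Φ i (fun _ => M n ω) ∂P - c)| ≤
        γ n * (w * (j * D - (1 - 2 * κ) * D) + j * (ε / 3)) := by
      rw [abs_mul, abs_of_nonneg (hγ0 n)]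
      refine mul_le_mul_of_nonneg_left ?_ (hγ0 n)
      refine (Finset.abs_sum_le_sum_abs _ _).trans ((Finset.sum_le_sum fun i _ => hn i).trans_eq ?_)
      rw [Finset.sum_add_distrib, ← Finset.mul_sum, Finset.sum_sub_distrib, ← Finset.mul_sum]
      simp only [Finset.sum_const, Finset.card_univ, nsmul_eq_mul, ← hj, ← hD]
    have b3 : j * (2 * γ n ^ 2 * D) ≤ j * γ n * (ε / 3) := by
      rw [show j * (2 * γ n ^ 2 * D) = j * γ n * (2 * D * γ n) by ring]
      exact mul_le_mul_of_nonneg_left hn3 (mul_nonneg hj0.le (hγ0 n))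
    have b4 : γ n * (w * (j * D - (1 - 2 * κ) * D) + j * (ε / 3)) =
        j * γ n * (w * (1 - (1 - 2 * κ) / j) * D + ε / 3) := by
      field_simp
    rw [e]
    have t1 := abs_add_le (a' - a - γ n * ∑ i, (∫ ω, splitAt K Φ i (fun _ => M n ω) ∂P - a))
      ((1 - j * γ n) * (a - c) + γ n * ∑ i, (∫ ω, splitAt K Φ i (fun _ => M n ω) ∂P - c))
    have t2 := abs_add_le ((1 - j * γ n) * (a - c))
      (γ n * ∑ i, (∫ ω, splitAt K Φ i (fun _ => M n ω) ∂P - c))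
    linarith
  have := eventually_le_of_relaxation (u := fun n => |∫ ω, Φ (fun _ => M n ω) ∂P - c|)
    (fun n => mul_nonneg hj0.le (hγ0 n)) (hjγ.eventually (ge_mem_nhds one_pos))
    (fun hs => hγs ((summable_mul_left_iff hj0.ne').1 hs)) hrel (show 0 < ε / 3 by positivity)
  filter_upwards [this] with n hn
  linarith

/-- `N` rounds of splitting, starting from the trivial bound by the total oscillation. The index
type is quantified inside the induction because a splitting is indexed by `Option ι`; each round
adds one coordinate, hence the denominators. -/
lemma IsUrn.eventually_le_prod [Nonempty C] (hU : IsUrn P K M X γ) (hγ0 : ∀ n, 0 ≤ γ n)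
    (hγ : Tendsto γ atTop (𝓝 0)) (hγs : ¬ Summable γ)
    (hκ : ∀ p q A, MeasurableSet A → |(K p).real A - (K q).real A| ≤ κ)
    (hν : drawOp K ν ν = ν) (N : ℕ) : ∀ {ι : Type} [DecidableEq ι] [Fintype ι] [Nonempty ι]
      {Φ : (ι → ProbabilityMeasure C) → ℝ} {δ : ι → ℝ}, IsMultiAffine Φ δ → ∀ ε > 0,
      ∀ᶠ n in atTop, |∫ ω, Φ (fun _ => M n ω) ∂P - Φ (fun _ => ν)| ≤
        (∏ k ∈ Finset.range N, (1 - (1 - 2 * κ) / (Fintype.card ι + k))) * ∑ i, δ i + ε := by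
  induction N with
  | zero =>
    intro ι _ _ _ Φ δ h ε hε
    refine Eventually.of_forall fun n => ?_
    have hi : Integrable (fun ω => Φ (fun _ => M n ω)) P :=
      h.integrable_comp (measurable_diag.comp (hU.measurable n))
    have e : ∫ ω, Φ (fun _ => M n ω) ∂P - Φ (fun _ => ν) =
        ∫ ω, (Φ (fun _ => M n ω) - Φ (fun _ => ν)) ∂P := by
      rw [integral_sub hi (integrable_const _)]
      simp
    rw [e, ← Real.norm_eq_abs]
    refine (norm_integral_le_of_norm_le_const (Eventually.of_forall fun ω =>
      h.abs_sub_le (fun _ => M n ω) fun _ => ν)).trans ?_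
    simp [hε.le]
  | succ N ih =>
    intro ι _ _ _ Φ δ h ε hε
    -- The shift `k + 1` accounts for the extra element of `Option ι`; the present round supplies
    -- the factor `k = 0`.
    have := hU.eventually_le_of_splitAt hγ0 hγ hγs hν h
      (w := ∏ k ∈ Finset.range N, (1 - (1 - 2 * κ) / (Fintype.card ι + (k + 1 : ℕ))))
      (κ := κ) (fun i ε' hε' => ?_) hε
    · simpa [Finset.prod_range_succ'] using this
    · have := ih (h.splitAt hκ i) ε' hε'
      simpa [Fintype.card_option, add_assoc, add_comm (1 : ℝ)] using this

/-- Along an urn whose kernel has Dobrushin coefficient less than `1 / 2`, the means of multi-affine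
functionals converge to their values at the fixed point. -/
theorem IsUrn.tendsto_integral [Nonempty C] (hU : IsUrn P K M X γ) (hγ0 : ∀ n, 0 ≤ γ n)
    (hγ : Tendsto γ atTop (𝓝 0)) (hγs : ¬ Summable γ)
    (hκ : ∀ p q A, MeasurableSet A → |(K p).real A - (K q).real A| ≤ κ)
    (h0 : 0 ≤ κ) (h1 : 2 * κ < 1)
    (hν : drawOp K ν ν = ν) {ι : Type} [DecidableEq ι] [Fintype ι] [Nonempty ι]
    {Φ : (ι → ProbabilityMeasure C) → ℝ} {δ : ι → ℝ} (h : IsMultiAffine Φ δ) :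
    Tendsto (fun n => ∫ ω, Φ (fun _ => M n ω) ∂P) atTop (𝓝 (Φ fun _ => ν)) := by
  have hj1 : (1 : ℝ) ≤ Fintype.card ι := by exact_mod_cast Fintype.card_pos
  have hD : 0 ≤ ∑ i, δ i := Finset.sum_nonneg fun i _ => h.osc_nonneg i
  rw [Metric.tendsto_atTop]
  intro ε hε
  -- The partial products themselves relax towards 0, with harmonic rates. The `+ 1` in the
  -- denominator covers a vanishing total oscillation.
  have hprod : ∀ᶠ N in atTop,
      ∏ k ∈ Finset.range N, (1 - (1 - 2 * κ) / ((Fintype.card ι : ℝ) + k)) ≤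
        0 + ε / (3 * (∑ i, δ i + 1)) := by
    refine eventually_le_of_relaxation
      (s := fun k : ℕ => (1 - 2 * κ) / ((Fintype.card ι : ℝ) + k)) (fun k => ?_)
      (Eventually.of_forall fun k => ?_) ?_ (Eventually.of_forall fun k => ?_) (by positivity)
    · exact div_nonneg (by linarith) (by positivity)
    · rw [div_le_one (by positivity)]
      linarith [Nat.cast_nonneg (α := ℝ) k]
    · simpa [add_comm] using not_summable_const_div_add (c := 1 - 2 * κ) (a := 1)
        (b := Fintype.card ι) (by linarith) one_pos (by positivity)
    · rw [Finset.prod_range_succ]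
      exact le_of_eq (by ring)
  obtain ⟨N, hN⟩ := hprod.exists
  obtain ⟨n₀, hn₀⟩ := eventually_atTop.1
    (hU.eventually_le_prod hγ0 hγ hγs hκ hν N h (ε / 3) (by positivity))
  refine ⟨n₀, fun n hn => ?_⟩
  rw [Real.dist_eq]
  have h2 := mul_le_mul_of_nonneg_right hN hD
  have h3 : (0 + ε / (3 * (∑ i, δ i + 1))) * ∑ i, δ i ≤ ε / 3 := by
    rw [zero_add, div_mul_eq_mul_div, div_le_div_iff₀ (by positivity) (by positivity)]
    nlinarith
  linarith [hn₀ n hn]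

end Convergence

/-! ### From second moments to weak convergence in probability -/

section WeakConvergence

lemma measurable_integral_probabilityMeasure {g : C → ℝ} (hg : Measurable g) :
    Measurable fun m : ProbabilityMeasure C => ∫ x, g x ∂(m : Measure C) :=
  (hg.stronglyMeasurable.integral_kernel
    (κ := (⟨fun m : ProbabilityMeasure C => (m : Measure C), measurable_subtype_coe⟩ :
      Kernel (ProbabilityMeasure C) C))).measurable

/-- On the diagonal this functional is the square of an integral. Its oscillation in a coordinate is
at most `B`, for the frozen factor, times `2 * B`. -/
lemma isMultiAffine_integral_mul_integral {g : C → ℝ} {B : ℝ} (hg : Measurable g)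
    (hB : ∀ x, |g x| ≤ B) :
    IsMultiAffine (fun μ : Bool → ProbabilityMeasure C =>
      (∫ x, g x ∂(μ true : Measure C)) * ∫ x, g x ∂(μ false : Measure C))
      (fun _ => 2 * B ^ 2) := by
  have hmeas := measurable_integral_probabilityMeasure hg
  have hint : ∀ l : ProbabilityMeasure C, |∫ x, g x ∂(l : Measure C)| ≤ B := fun l => by
    simpa using norm_integral_le_of_norm_le_const (μ := (l : Measure C))
      (Eventually.of_forall fun x => (Real.norm_eq_abs (g x)).trans_le (hB x))
  have hosc : ∀ (l : ProbabilityMeasure C) (x y : C),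
      (∫ z, g z ∂(l : Measure C)) * g x - (∫ z, g z ∂(l : Measure C)) * g y ≤ 2 * B ^ 2 := by
    intro l x y
    have h1 : |g x - g y| ≤ 2 * B := (abs_sub _ _).trans (by linarith [hB x, hB y])
    rw [← mul_sub]
    refine (le_abs_self _).trans ?_
    rw [abs_mul]
    calc _ ≤ B * (2 * B) := mul_le_mul (hint l) h1 (abs_nonneg _) ((abs_nonneg _).trans (hint l))
      _ = 2 * B ^ 2 := by ring
  refine ⟨(hmeas.comp (measurable_pi_apply true)).mul (hmeas.comp (measurable_pi_apply false)), ?_⟩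
  rintro (_ | _) μ
  · refine ⟨fun x => (∫ z, g z ∂(μ true : Measure C)) * g x, hg.const_mul _, hosc _, fun l => ?_⟩
    simp [integral_const_mul]
  · refine ⟨fun x => (∫ z, g z ∂(μ false : Measure C)) * g x, hg.const_mul _, hosc _, fun l => ?_⟩
    simp only [Function.update_self, integral_const_mul]
    simp [mul_comm]

/-- The sets that contain `M n` with probability tending to one form a filter `G`, by monotonicity
and subadditivity, which hold for non-measurable sets too. For an initial topology, `G ≤ 𝓝 ν` can be
checked on one test function at a time. -/
lemma tendstoWeaklyInProbability_of_integral {Ω : Type*} {mΩ : MeasurableSpace Ω} {P : Measure Ω}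
    [IsProbabilityMeasure P] {M : ℕ → Ω → ProbabilityMeasure C} {ν : ProbabilityMeasure C}
    (h : ∀ f : C → ℝ, Measurable f → (∃ B, ∀ x, |f x| ≤ B) → ∀ ε > 0,
      Tendsto (fun n => P {ω | ε ≤ |∫ x, f x ∂(M n ω : Measure C) - ∫ x, f x ∂(ν : Measure C)|})
        atTop (𝓝 0)) :
    TendstoWeaklyInProbability P M ν := by
  let G : Filter (ProbabilityMeasure C) :=
    { sets := {V | Tendsto (fun n => P {ω | M n ω ∉ V}) atTop (𝓝 0)}
      univ_sets := by simp
      sets_of_superset := fun {V W} hV hVW =>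
        tendsto_of_tendsto_of_tendsto_of_le_of_le tendsto_const_nhds hV (fun _ => zero_le)
          fun n => measure_mono fun ω hω hωV => hω (hVW hωV)
      inter_sets := fun {V W} hV hW => by
        have hsum : Tendsto (fun n => P {ω | M n ω ∉ V} + P {ω | M n ω ∉ W}) atTop (𝓝 0) := by
          simpa using hV.add hW
        refine tendsto_of_tendsto_of_tendsto_of_le_of_le tendsto_const_nhds hsum
          (fun _ => zero_le) fun n => (measure_mono fun ω hω => ?_).trans (measure_union_le _ _)
        by_contra hcon
        simp only [Set.mem_union, Set.mem_ofPred_eq, not_or, not_not] at hcon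
        exact hω hcon }
  have hG : G ≤ @nhds _ (weakTopology C) ν := by
    simp only [nhds_iInf, nhds_induced]
    refine le_iInf fun f => le_iInf fun hf => ?_
    rw [← tendsto_iff_comap, Metric.tendsto_nhds]
    intro ε hε
    have := h f hf.1 hf.2 ε hε
    change Tendsto _ _ _
    simpa [Real.dist_eq] using this
  intro U hU hνU
  exact hG (@IsOpen.mem_nhds _ (weakTopology C) _ _ hU hνU)

variable {Ω : Type*} [MeasurableSpace Ω] {P : Measure Ω} [IsProbabilityMeasure P]
  {K : Kernel (C × C) C} [IsMarkovKernel K] {M : ℕ → Ω → ProbabilityMeasure C}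
  {X : ℕ → Ω → C × C} {γ : ℕ → ℝ} {κ : ℝ} {ν : ProbabilityMeasure C}

theorem IsUrn.tendstoWeaklyInProbability [Nonempty C] (hU : IsUrn P K M X γ)
    (hγ0 : ∀ n, 0 ≤ γ n) (hγ : Tendsto γ atTop (𝓝 0)) (hγs : ¬ Summable γ)
    (hκ : ∀ p q A, MeasurableSet A → |(K p).real A - (K q).real A| ≤ κ)
    (h0 : 0 ≤ κ) (h1 : 2 * κ < 1) (hν : drawOp K ν ν = ν) :
    TendstoWeaklyInProbability P M ν := by
  refine tendstoWeaklyInProbability_of_integral fun f hf hB ε hε => ?_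
  obtain ⟨B, hB⟩ := hB
  set c := ∫ x, f x ∂(ν : Measure C) with hc
  have hfi : ∀ l : ProbabilityMeasure C, Integrable f (l : Measure C) := fun l =>
    Integrable.of_bound hf.aestronglyMeasurable B (Eventually.of_forall hB)
  have hcent : ∀ l : ProbabilityMeasure C,
      ∫ x, (f x - c) ∂(l : Measure C) = ∫ x, f x ∂(l : Measure C) - c := fun l => by
    rw [integral_sub (hfi l) (integrable_const c)]
    simp
  have hg : Measurable fun x => f x - c := hf.sub measurable_const
  -- Centring `f` at its mean under `ν` makes the limit value 0, so the mean of the functional is a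
  -- second moment that vanishes asymptotically.
  have hΦ := isMultiAffine_integral_mul_integral hg (B := B + |c|)
    fun x => (abs_sub _ _).trans (by linarith [hB x])
  have hlim := hU.tendsto_integral hγ0 hγ hγs hκ h0 h1 hν hΦ
  simp only [hcent, ← hc, sub_self, ← sq] at hlim
  have hi : ∀ n, Integrable (fun ω => (∫ x, f x ∂(M n ω : Measure C) - c) ^ 2) P := fun n => by
    have := hΦ.integrable_comp (P := P) (measurable_diag.comp (hU.measurable n))
    simpa only [Function.comp_def, hcent, ← sq] using this
  have hle : ∀ n, P.real {ω | ε ≤ |∫ x, f x ∂(M n ω : Measure C) - c|} ≤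
      (ε ^ 2)⁻¹ * ∫ ω, (∫ x, f x ∂(M n ω : Measure C) - c) ^ 2 ∂P := by
    intro n
    have h2 := mul_meas_ge_le_integral_of_nonneg
      (Eventually.of_forall fun ω => sq_nonneg (∫ x, f x ∂(M n ω : Measure C) - c)) (hi n) (ε ^ 2)
    rw [inv_mul_eq_div, le_div_iff₀' (by positivity)]
    refine le_trans (mul_le_mul_of_nonneg_left (measureReal_mono fun ω hω => ?_)
      (by positivity)) h2
    have h3 : ε ≤ |∫ x, f x ∂(M n ω : Measure C) - c| := hω
    have h4 : ε ^ 2 ≤ |∫ x, f x ∂(M n ω : Measure C) - c| ^ 2 := by gcongr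
    rwa [sq_abs] at h4
  have hreal : Tendsto (fun n => P.real {ω | ε ≤ |∫ x, f x ∂(M n ω : Measure C) - c|}) atTop
      (𝓝 0) :=
    squeeze_zero (fun _ => measureReal_nonneg) hle (by simpa using hlim.const_mul (ε ^ 2)⁻¹)
  rw [← ENNReal.tendsto_toReal_iff (fun n => measure_ne_top _ _) ENNReal.zero_ne_top]
  simpa [measureReal_def] using hreal

end WeakConvergence

/-! ### The normalized kernel and the ergodicity coefficients -/

section Normalization

variable {ρ : Kernel (C × C) C} {σ : ℝ≥0}

/-- The Markov kernel `σ⁻¹ • ρ`. -/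
def normalizedKernel (ρ : Kernel (C × C) C) (σ : ℝ≥0) : Kernel (C × C) C where
  toFun p := σ⁻¹ • ρ p
  measurable' := by
    refine Measure.measurable_of_measurable_coe _ fun s hs => ?_
    simpa only [Measure.coe_nnreal_smul_apply] using (ρ.measurable_coe hs).const_mul _

lemma normalizedKernel_apply (p : C × C) : normalizedKernel ρ σ p = σ⁻¹ • ρ p := rfl

lemma smul_normalizedKernel (hσ : 0 < σ) (p : C × C) : σ • normalizedKernel ρ σ p = ρ p := by
  rw [normalizedKernel_apply, smul_smul, mul_inv_cancel₀ hσ.ne', one_smul]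

lemma isMarkovKernel_normalizedKernel (hσ : 0 < σ) (hB : ∀ x y : C, ρ (x, y) Set.univ = σ) :
    IsMarkovKernel (normalizedKernel ρ σ) := by
  refine ⟨fun p => ⟨?_⟩⟩
  rw [normalizedKernel_apply, Measure.coe_nnreal_smul_apply, hB p.1 p.2, ← ENNReal.coe_mul,
    inv_mul_cancel₀ hσ.ne', ENNReal.coe_one]

lemma replacementOp_eq_smul_drawOp (hσ : 0 < σ) [IsMarkovKernel (normalizedKernel ρ σ)]
    (μ ν : ProbabilityMeasure C) :
    replacementOp ρ μ ν = σ • (drawOp (normalizedKernel ρ σ) ν μ : Measure C) := by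
  ext A hA
  rw [replacementOp, coe_drawOp, Measure.coe_nnreal_smul_apply,
    Measure.bind_apply hA ρ.measurable.aemeasurable,
    Measure.bind_apply hA (Kernel.measurable _).aemeasurable,
    ← lintegral_const_mul _ (Kernel.measurable_coe _ hA)]
  simp_rw [← smul_normalizedKernel (ρ := ρ) hσ, Measure.coe_nnreal_smul_apply]

lemma smul_eq_replacementOp_iff (hσ : 0 < σ) [IsMarkovKernel (normalizedKernel ρ σ)]
    (ν : ProbabilityMeasure C) :
    σ • (ν : Measure C) = replacementOp ρ ν ν ↔ drawOp (normalizedKernel ρ σ) ν ν = ν := by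
  rw [replacementOp_eq_smul_drawOp hσ]
  constructor
  · intro h
    refine Subtype.ext ?_
    have := congrArg (fun m : Measure C => σ⁻¹ • m) h
    simpa [smul_smul, inv_mul_cancel₀ hσ.ne'] using this.symm
  · intro h
    rw [h]

lemma pairOp_dirac [IsMarkovKernel (normalizedKernel ρ σ)] (hσ : 0 < σ) (p q : C × C) :
    pairOp ρ σ (Measure.dirac p) (Measure.dirac q) =
      (normalizedKernel ρ σ p).prod (normalizedKernel ρ σ q) := by
  have hρ : ∀ p, ρ p = σ • normalizedKernel ρ σ p := fun p => (smul_normalizedKernel hσ p).symm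
  have hm : Measurable fun r : (C × C) × (C × C) => (ρ r.1).prod (ρ r.2) := by
    have : ∀ p, IsFiniteMeasure (ρ p) := fun p => by rw [hρ]; infer_instance
    let f : C × C → FiniteMeasure C := fun p => ⟨ρ p, this p⟩
    have hf : Measurable f := ρ.measurable.subtype_mk
    exact FiniteMeasure.measurable_fun_prod.comp
      ((hf.comp measurable_fst).prodMk (hf.comp measurable_snd))
  rw [pairOp, Measure.dirac_prod_dirac, Measure.dirac_bind hm, hρ p, hρ q]
  ext A hA
  have e : ((σ • normalizedKernel ρ σ p).prod (σ • normalizedKernel ρ σ q)) =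
      (σ ^ 2) • ((normalizedKernel ρ σ p).prod (normalizedKernel ρ σ q)) := by
    refine Measure.ext_prod fun {s t} hs ht => ?_
    simp only [Measure.prod_prod, Measure.coe_nnreal_smul_apply, ENNReal.coe_pow]
    ring
  rw [e, smul_smul, inv_mul_cancel₀ (pow_ne_zero 2 hσ.ne'), one_smul]

lemma tvDist_le_one {S : Type*} [MeasurableSpace S] (μ ν : Measure S) [IsProbabilityMeasure μ]
    [IsProbabilityMeasure ν] : tvDist μ ν ≤ 1 := by
  refine iSup₂_le fun A _ => ?_
  rw [← ENNReal.ofReal_one]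
  refine ENNReal.ofReal_le_ofReal ?_
  have h1 : μ.real A ≤ 1 := measureReal_le_one
  have h2 : ν.real A ≤ 1 := measureReal_le_one
  have h3 : 0 ≤ μ.real A := measureReal_nonneg
  have h4 : 0 ≤ ν.real A := measureReal_nonneg
  exact abs_sub_le_iff.2 ⟨by linarith, by linarith⟩

/-- Dividing by a total variation distance, which is at most 1, can only increase the numerator. -/
lemma abs_real_sub_le_ergodicityCoeff {S : Type*} [MeasurableSpace S] (T : Measure S → Measure S)
    {ν₁ ν₂ : ProbabilityMeasure S} (hne : ν₁ ≠ ν₂) {A : Set S} (hA : MeasurableSet A) :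
    ENNReal.ofReal |(T ν₁).real A - (T ν₂).real A| ≤ ergodicityCoeff T :=
  calc ENNReal.ofReal |(T ν₁).real A - (T ν₂).real A| ≤ tvDist (T ν₁) (T ν₂) :=
        le_iSup₂ (f := fun (A : Set S) (_ : MeasurableSet A) =>
          ENNReal.ofReal |(T ν₁).real A - (T ν₂).real A|) A hA
    _ = tvDist (T ν₁) (T ν₂) / 1 := (div_one _).symm
    _ ≤ tvDist (T ν₁) (T ν₂) / tvDist (ν₁ : Measure S) (ν₂ : Measure S) :=
        ENNReal.div_le_div_left (tvDist_le_one _ _) _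
    _ ≤ ergodicityCoeff T :=
        le_iSup_of_le ν₁ (le_iSup_of_le ν₂ (le_iSup_of_le hne le_rfl))

/-- Distinct points need not be separated by the σ-algebra, whereas `ergodicityCoeff` sees only
distinct measures; this settles the remaining case. -/
lemma kernel_eq_of_dirac_eq {S T : Type*} [MeasurableSpace S] [MeasurableSpace T] (K : Kernel S T)
    {p q : S} (h : Measure.dirac p = Measure.dirac q) : K p = K q := by
  rw [← Measure.dirac_bind K.measurable p, ← Measure.dirac_bind K.measurable q, h]

lemma abs_normalizedKernel_sub_le (hσ : 0 < σ) [IsMarkovKernel (normalizedKernel ρ σ)]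
    (p q : C × C) {A : Set C} (hA : MeasurableSet A) :
    ENNReal.ofReal |(normalizedKernel ρ σ p).real A - (normalizedKernel ρ σ q).real A| ≤
        tauLeft (pairOp ρ σ) ∧
      ENNReal.ofReal |(normalizedKernel ρ σ p).real A - (normalizedKernel ρ σ q).real A| ≤
        tauRight (pairOp ρ σ) := by
  let D : C × C → ProbabilityMeasure (C × C) := fun p => ⟨Measure.dirac p, inferInstance⟩
  by_cases hpq : D p = D q
  · rw [kernel_eq_of_dirac_eq (normalizedKernel ρ σ) (congrArg Subtype.val hpq)]
    simp
  constructor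
  -- One argument is frozen at a Dirac mass, and rectangles with one full side leave only the
  -- marginal that varies.
  · have h := abs_real_sub_le_ergodicityCoeff (fun ν => pairOp ρ σ (D p) ν) hpq
      (MeasurableSet.univ.prod hA)
    refine le_trans (le_of_eq ?_)
      (h.trans (le_iSup (fun μ : ProbabilityMeasure (C × C) =>
        ergodicityCoeff fun ν => pairOp ρ σ μ ν) (D p)))
    simp [D, pairOp_dirac hσ, measureReal_prod_prod]
  · have h := abs_real_sub_le_ergodicityCoeff (fun μ => pairOp ρ σ μ (D p)) hpq
      (hA.prod MeasurableSet.univ)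
    refine le_trans (le_of_eq ?_)
      (h.trans (le_iSup (fun ν : ProbabilityMeasure (C × C) =>
        ergodicityCoeff fun μ => pairOp ρ σ μ ν) (D p)))
    simp [D, pairOp_dirac hσ, measureReal_prod_prod]

/-- The hypothesis on the ergodicity coefficients of `pairOp` bounds the Dobrushin coefficient of
the normalized kernel by a number less than `1 / 2`. -/
lemma exists_contraction_const (hσ : 0 < σ) [IsMarkovKernel (normalizedKernel ρ σ)]
    (hE : tauLeft (pairOp ρ σ) + tauRight (pairOp ρ σ) < 1) :
    ∃ κ : ℝ, 0 ≤ κ ∧ 2 * κ < 1 ∧ ∀ p q A, MeasurableSet A →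
      |(normalizedKernel ρ σ p).real A - (normalizedKernel ρ σ q).real A| ≤ κ := by
  have hne := ne_top_of_lt hE
  obtain ⟨hl, hr⟩ := ENNReal.add_ne_top.1 hne
  have h1 : (tauLeft (pairOp ρ σ)).toReal + (tauRight (pairOp ρ σ)).toReal < 1 := by
    rw [← ENNReal.toReal_add hl hr, ← ENNReal.toReal_one]
    exact (ENNReal.toReal_lt_toReal hne ENNReal.one_ne_top).2 hE
  -- Both coefficients are valid bounds, hence so is their mean, which is below 1/2.
  refine ⟨((tauLeft (pairOp ρ σ)).toReal + (tauRight (pairOp ρ σ)).toReal) / 2, by positivity,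
    by linarith, fun p q A hA => ?_⟩
  obtain ⟨h2, h3⟩ := abs_normalizedKernel_sub_le (ρ := ρ) hσ p q hA
  rw [ENNReal.ofReal_le_iff_le_toReal hl] at h2
  rw [ENNReal.ofReal_le_iff_le_toReal hr] at h3
  linarith

end Normalization

/-! ### The Pólya process as an urn -/

section CompositionProcess

variable [Nonempty C] {Ω : Type*} {mΩ : MeasurableSpace Ω} {P : Measure Ω}
  {ℱ : Filtration ℕ mΩ} {ρ : Kernel (C × C) C} {σ : ℝ≥0} {m₀ : FiniteMeasure C}
  {m : ℕ → Ω → FiniteMeasure C} {C₁ C₂ : ℕ → Ω → C}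

/-- Balance makes the total mass deterministic, which is why the mixing weights of the urn are not
random. -/
lemma IsPolyaProcess.mass_eq (h : IsPolyaProcess P ℱ ρ m₀ m C₁ C₂)
    (hB : ∀ x y : C, ρ (x, y) Set.univ = σ) (n : ℕ) (ω : Ω) :
    (m n ω).mass = m₀.mass + n * σ := by
  induction n with
  | zero => simp [h.zero]
  | succ n ih =>
    rw [← ENNReal.coe_inj, FiniteMeasure.ennreal_mass, h.succ, Measure.add_apply, hB,
      ← FiniteMeasure.ennreal_mass, ih]
    push_cast
    ring

lemma IsPolyaProcess.measurable_pair (h : IsPolyaProcess P ℱ ρ m₀ m C₁ C₂) (n : ℕ) :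
    Measurable[ℱ (n + 1)] fun ω => (C₁ (n + 1) ω, C₂ (n + 1) ω) :=
  (h.measurable_fst n).prodMk (h.measurable_snd n)

lemma IsPolyaProcess.measurable_coe (h : IsPolyaProcess P ℱ ρ m₀ m C₁ C₂) (n : ℕ) :
    Measurable[ℱ n] fun ω => (m n ω : Measure C) := by
  induction n with
  | zero =>
    simp_rw [h.zero]
    exact measurable_const
  | succ n ih =>
    simp_rw [h.succ]
    refine @Measure.measurable_of_measurable_coe _ _ _ (ℱ (n + 1)) _ fun s hs => ?_
    have h1 : Measurable[ℱ (n + 1)] fun ω => (m n ω : Measure C) s :=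
      (Measure.measurable_coe hs).comp (ih.mono (ℱ.mono (Nat.le_succ n)) le_rfl)
    have h2 : Measurable[ℱ (n + 1)] fun ω => ρ (C₁ (n + 1) ω, C₂ (n + 1) ω) s :=
      (ρ.measurable_coe hs).comp (h.measurable_pair n)
    simp only [Measure.add_apply]
    exact h1.add h2

lemma IsPolyaProcess.ne_zero (h : IsPolyaProcess P ℱ ρ m₀ m C₁ C₂)
    (hB : ∀ x y : C, ρ (x, y) Set.univ = σ) (h0 : m₀ ≠ 0) (n : ℕ) (ω : Ω) : m n ω ≠ 0 := by
  rw [← FiniteMeasure.mass_nonzero_iff, h.mass_eq hB]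
  have := m₀.mass_nonzero_iff.2 h0
  positivity

lemma IsPolyaProcess.measurable_normalize (h : IsPolyaProcess P ℱ ρ m₀ m C₁ C₂)
    (hB : ∀ x y : C, ρ (x, y) Set.univ = σ) (h0 : m₀ ≠ 0) (n : ℕ) :
    Measurable[ℱ n] fun ω => (m n ω).normalize := by
  have h1 : Measurable[ℱ n] fun ω => ((m n ω).normalize : Measure C) := by
    refine @Measure.measurable_of_measurable_coe _ _ _ (ℱ n) _ fun s hs => ?_
    have e : ∀ ω, ((m n ω).normalize : Measure C) s =
        ((m₀.mass + n * σ)⁻¹ : ℝ≥0) * (m n ω : Measure C) s := fun ω => by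
      rw [FiniteMeasure.toMeasure_normalize_eq_of_nonzero _ (h.ne_zero hB h0 n ω), h.mass_eq hB]
      exact Measure.coe_nnreal_smul_apply _ _ _
    simp_rw [e]
    exact ((Measure.measurable_coe hs).comp (h.measurable_coe n)).const_mul _
  exact h1.subtype_mk

/-- The weight of the new colour in the composition at time `n + 1`. -/
def stepWeight (a σ : ℝ≥0) (n : ℕ) : ℝ := σ / (σ * n + (a + σ))

lemma IsPolyaProcess.normalize_succ (h : IsPolyaProcess P ℱ ρ m₀ m C₁ C₂) (hσ : 0 < σ)
    (hB : ∀ x y : C, ρ (x, y) Set.univ = σ) (h0 : m₀ ≠ 0) (n : ℕ) (ω : Ω) :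
    ((m (n + 1) ω).normalize : Measure C) =
      ENNReal.ofReal (1 - stepWeight m₀.mass σ n) • ((m n ω).normalize : Measure C) +
        ENNReal.ofReal (stepWeight m₀.mass σ n) •
          normalizedKernel ρ σ (C₁ (n + 1) ω, C₂ (n + 1) ω) := by
  have hm : (m n ω : Measure C) = (m₀.mass + n * σ) • ((m n ω).normalize : Measure C) := by
    have := congrArg (fun μ : FiniteMeasure C => (μ : Measure C))
      (m n ω).self_eq_mass_smul_normalize
    rwa [h.mass_eq hB] at this
  have ha : (0 : ℝ) < m₀.mass := NNReal.coe_pos.2 (pos_iff_ne_zero.2 (m₀.mass_nonzero_iff.2 h0))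
  have hs : (0 : ℝ) < σ := hσ
  rw [FiniteMeasure.toMeasure_normalize_eq_of_nonzero _ (h.ne_zero hB h0 (n + 1) ω), h.succ,
    h.mass_eq hB, hm, ← smul_normalizedKernel (ρ := ρ) hσ, smul_add, smul_smul, smul_smul]
  have e1 : ENNReal.ofReal (1 - stepWeight m₀.mass σ n) =
      (((m₀.mass + (n + 1 : ℕ) * σ)⁻¹ * (m₀.mass + n * σ) : ℝ≥0) : ℝ≥0∞) := by
    rw [← ENNReal.ofReal_coe_nnreal]
    congr 1
    push_cast
    rw [stepWeight, eq_inv_mul_iff_mul_eq₀ (by positivity)]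
    field_simp
    ring
  have e2 : ENNReal.ofReal (stepWeight m₀.mass σ n) =
      (((m₀.mass + (n + 1 : ℕ) * σ)⁻¹ * σ : ℝ≥0) : ℝ≥0∞) := by
    rw [← ENNReal.ofReal_coe_nnreal]
    congr 1
    push_cast
    rw [stepWeight, eq_inv_mul_iff_mul_eq₀ (by positivity)]
    field_simp
    ring
  rw [e1, e2]
  rfl

variable [IsProbabilityMeasure P]

/-- The unconditional form of the conditional law of the drawn pairs. -/
lemma IsPolyaProcess.map_draw (h : IsPolyaProcess P ℱ ρ m₀ m C₁ C₂)
    (hB : ∀ x y : C, ρ (x, y) Set.univ = σ) (h0 : m₀ ≠ 0) (n : ℕ) :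
    P.map (fun ω => ((m n ω).normalize, (C₁ (n + 1) ω, C₂ (n + 1) ω))) =
      (P.map fun ω => (m n ω).normalize) ⊗ₘ (pairKernel C) := by
  have hM := h.measurable_normalize hB h0 n
  have hM' : Measurable fun ω => (m n ω).normalize := hM.mono (ℱ.le n) le_rfl
  have hX' : Measurable fun ω => (C₁ (n + 1) ω, C₂ (n + 1) ω) :=
    (h.measurable_pair n).mono (ℱ.le (n + 1)) le_rfl
  have hprob : IsProbabilityMeasure
      (P.map fun ω => ((m n ω).normalize, (C₁ (n + 1) ω, C₂ (n + 1) ω))) :=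
    Measure.isProbabilityMeasure_map (hM'.prodMk hX').aemeasurable
  refine Measure.ext_prod fun {s t} hs ht => ?_
  rw [Measure.map_apply (hM'.prodMk hX') (hs.prod ht), Measure.compProd_apply_prod hs ht,
    setLIntegral_map hs ((pairKernel C).measurable_coe ht) hM']
  -- Rectangles determine the joint law, and on `s ×ˢ t` it is the conditional probability of `t`
  -- integrated over an event of `ℱ n`.
  have hset := setIntegral_condExp (ℱ.le n) (μ := P)
    (f := ((fun ω => (C₁ (n + 1) ω, C₂ (n + 1) ω)) ⁻¹' t).indicator fun _ => (1 : ℝ))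
    ((integrable_const 1).indicator (hX' ht)) (hM hs)
  rw [setIntegral_congr_ae (g := fun ω => (((m n ω).normalize : Measure C).prod
      ((m n ω).normalize : Measure C)).real t) (ℱ.le n _ (hM hs))
      ((h.cond_law n t ht).mono fun ω hω _ => hω),
    setIntegral_indicator (hX' ht), setIntegral_const, smul_eq_mul, mul_one] at hset
  have hmeas : Measurable fun ω => pairKernel C (m n ω).normalize t :=
    ((pairKernel C).measurable_coe ht).comp hM'
  have hint := integral_toReal (μ := P.restrict ((fun ω => (m n ω).normalize) ⁻¹' s))
    hmeas.aemeasurable (Eventually.of_forall fun ω => measure_lt_top _ _)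
  have hfin : ∫⁻ ω in (fun ω => (m n ω).normalize) ⁻¹' s, pairKernel C (m n ω).normalize t ∂P ≠
      ∞ := by
    refine ne_top_of_le_ne_top ENNReal.one_ne_top
      ((lintegral_mono fun ω => prob_le_one).trans ?_)
    simpa using prob_le_one
  refine (ENNReal.toReal_eq_toReal_iff' (measure_ne_top _ _) hfin).1 ?_
  rw [← hint]
  exact hset.symm

lemma IsPolyaProcess.isUrn (h : IsPolyaProcess P ℱ ρ m₀ m C₁ C₂) (hσ : 0 < σ)
    (hB : ∀ x y : C, ρ (x, y) Set.univ = σ) (h0 : m₀ ≠ 0)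
    [IsMarkovKernel (normalizedKernel ρ σ)] :
    IsUrn P (normalizedKernel ρ σ) (fun n ω => (m n ω).normalize)
      (fun n ω => (C₁ (n + 1) ω, C₂ (n + 1) ω)) (stepWeight m₀.mass σ) where
  measurable n := (h.measurable_normalize hB h0 n).mono (ℱ.le n) le_rfl
  measurable_draw n := (h.measurable_pair n).mono (ℱ.le (n + 1)) le_rfl
  map_draw n := h.map_draw hB h0 n
  mix n ω := h.normalize_succ hσ hB h0 n ω

lemma stepWeight_nonneg (a σ : ℝ≥0) (n : ℕ) : 0 ≤ stepWeight a σ n := by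
  unfold stepWeight
  positivity

lemma tendsto_stepWeight (a : ℝ≥0) {σ : ℝ≥0} (hσ : 0 < σ) :
    Tendsto (stepWeight a σ) atTop (𝓝 0) :=
  Tendsto.div_atTop tendsto_const_nhds (tendsto_atTop_add_const_right _ _
    (tendsto_natCast_atTop_atTop.const_mul_atTop (NNReal.coe_pos.2 hσ)))

lemma not_summable_stepWeight (a : ℝ≥0) {σ : ℝ≥0} (hσ : 0 < σ) :
    ¬ Summable (stepWeight a σ) :=
  not_summable_const_div_add (NNReal.coe_pos.2 hσ) (NNReal.coe_pos.2 hσ) (by positivity)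

end CompositionProcess

end PolyaUrn

end

theorem mainTheorem4 {C : Type u} [MeasurableSpace C] [Nonempty C]
    (ρ : ProbabilityTheory.Kernel (C × C) C) (σ : ℝ≥0) (hσ : 0 < σ)
    (hB : ∀ x y : C, ρ (x, y) Set.univ = σ)
    (hE : PolyaUrn.tauLeft (PolyaUrn.pairOp ρ σ) + PolyaUrn.tauRight (PolyaUrn.pairOp ρ σ) < 1) :
    ∃ ν : ProbabilityMeasure C,
      σ • (ν : Measure C) = PolyaUrn.replacementOp ρ ν ν ∧
      (∀ ν' : ProbabilityMeasure C,
        σ • (ν' : Measure C) = PolyaUrn.replacementOp ρ ν' ν' → ν' = ν) ∧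
      ∀ {Ω : Type v} {mΩ : MeasurableSpace Ω} (P : Measure Ω) [IsProbabilityMeasure P]
        (ℱ : Filtration ℕ mΩ) (m₀ : FiniteMeasure C) (_ : m₀ ≠ 0)
        (m : ℕ → Ω → FiniteMeasure C) (C₁ C₂ : ℕ → Ω → C),
        PolyaUrn.IsPolyaProcess P ℱ ρ m₀ m C₁ C₂ →
        PolyaUrn.TendstoWeaklyInProbability P (fun n ω => (m n ω).normalize) ν := by
  have hK := PolyaUrn.isMarkovKernel_normalizedKernel hσ hB
  obtain ⟨κ, h0, h1, hκ⟩ := PolyaUrn.exists_contraction_const hσ hE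
  obtain ⟨ν, hν⟩ := PolyaUrn.exists_drawOp_fixed hκ h0 h1
  refine ⟨ν, (PolyaUrn.smul_eq_replacementOp_iff hσ ν).2 hν, fun ν' hν' => ?_, ?_⟩
  · exact PolyaUrn.drawOp_fixed_unique hκ h0 h1
      ((PolyaUrn.smul_eq_replacementOp_iff hσ ν').1 hν') hν
  · intro Ω mΩ P _ ℱ m₀ hm₀ m C₁ C₂ h
    exact (h.isUrn hσ hB hm₀).tendstoWeaklyInProbability (PolyaUrn.stepWeight_nonneg _ _)
      (PolyaUrn.tendsto_stepWeight _ hσ) (PolyaUrn.not_summable_stepWeight _ hσ) hκ h0 h1 hν
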